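/- Let $H^2$ be the hyperbolic plane of curvature $-1$. The thickness (minimal width) of a convex body $K\subset H^2$ is the minimum, over all supporting lines $\ell$ of $K$, of the distance between $\ell$ and a supporting line of $K$ most distant from $\ell$. Let $n\ge 3$ be odd and let $R\subset H^2$ be a convex $n$-gon with vertices $v_1,\dots,v_n$ in positive cyclic order (indices mod $n$). For each $i$ let $t_i$ be the orthogonal projection of $v_i$ on the line through $v_{i+\frac{n-1}{2}}$ and $v_{i+\frac{n+1}{2}}$. Suppose that $R$ is an ordinary reduced polygon of thickness $w$, that is, the thickness of $R$ is $w$, each $v_i$ has distance $w$ from the opposite side $[v_{i+\frac{n-1}{2}},v_{i+\frac{n+1}{2}}]$, and each $t_i$ lies in the relative interior of this side. Then for each $i$ the geodesic segments $[v_i,t_i]$ and $[v_{i+\frac{n+1}{2}},t_{i+\frac{n+1}{2}}]$ intersect in exactly one point $p_i$, the angles $\angle(v_i,p_i,t_{i+\frac{n+1}{2}})$ and $\angle(t_i,p_i,v_{i+\frac{n+1}{2}})$ have the same value $\varphi_i$, and the (finite) area of $R$ is $$\operatorname{area}(R)=(n-2)\pi-2\sum_{i=1}^n F_w(\varphi_i),$$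 where $F_w(x)=f_w(g_w(x))$ with $$f_w(x)=\arcsin\frac{x\sqrt{1-\tanh^2 w}}{\tanh w-x},\qquad g_w(x)=\frac{1+\cos x-\sqrt{(1+\cos x)^2-4\tanh^2 w\,\cos x}}{2\tanh w}.$$ -/

import Mathlib

/-! The hyperbolic plane (curvature `-1`) is Mathlib's upper half-plane `UpperHalfPlane`, with its
hyperbolic metric `dist` and its invariant measure `volume`, of density `dx dy / y ^ 2`. -/

namespace HypPlane

/-- The geodesic segment `[x, y]`. -/
def seg (x y : UpperHalfPlane) : Set UpperHalfPlane :=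
  {z | dist x z + dist z y = dist x y}

/-- The relative interior of the geodesic segment `[x, y]`. -/
def openSeg (x y : UpperHalfPlane) : Set UpperHalfPlane :=
  seg x y \ {x, y}

/-- The hyperbolic line through `x` and `y` (meant for `x ≠ y`). -/
def line (x y : UpperHalfPlane) : Set UpperHalfPlane :=
  {z | z ∈ seg x y ∨ y ∈ seg x z ∨ x ∈ seg z y}

/-- `ℓ` is a hyperbolic line. -/
def IsLine (ℓ : Set UpperHalfPlane) : Prop :=
  ∃ x y, x ≠ y ∧ ℓ = line x y

/-- `H` is one of the two closed half-planes bounded by the line `ℓ`: the line together with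
all points that are on the same side of `ℓ` as some point `a` off the line. -/
def IsClosedHalfPlane (ℓ H : Set UpperHalfPlane) : Prop :=
  ∃ a, a ∉ ℓ ∧ H = ℓ ∪ {z | Disjoint (seg a z) ℓ}

/-- Geodesic convexity. -/
def IsConvex (K : Set UpperHalfPlane) : Prop :=
  ∀ x ∈ K, ∀ y ∈ K, seg x y ⊆ K

/-- The hyperbolic convex hull. -/
def hull (X : Set UpperHalfPlane) : Set UpperHalfPlane :=
  ⋂₀ {C | IsConvex C ∧ X ⊆ C}

/-- `ℓ` is a supporting line of `K`. -/
def IsSupportingLine (K ℓ : Set UpperHalfPlane) : Prop :=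
  IsLine ℓ ∧ (K ∩ ℓ).Nonempty ∧ ∃ H, IsClosedHalfPlane ℓ H ∧ K ⊆ H

/-- The distance of two sets (the infimum of the distances of their points). -/
noncomputable def setDist (A B : Set UpperHalfPlane) : ℝ :=
  sInf (Set.image2 dist A B)

/-- The width of `K` with respect to the supporting line `ℓ`: the distance of `ℓ` and a most
distant supporting line. -/
noncomputable def width (K ℓ : Set UpperHalfPlane) : ℝ :=
  sSup {d | ∃ ℓ', IsSupportingLine K ℓ' ∧ d = setDist ℓ ℓ'}

/-- The thickness (minimal width) of `K`. -/
noncomputable def thickness (K : Set UpperHalfPlane) : ℝ :=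
  sInf {d | ∃ ℓ, IsSupportingLine K ℓ ∧ d = width K ℓ}

/-- The point `z` seen in the Poincaré disc model centred at `p`: the Cayley transform
`z ↦ (z - p) / (z - conj p)` is an orientation preserving conformal bijection of the upper half-plane
onto the unit disc, an isometry for the hyperbolic metrics, which takes `p` to `0`. The geodesic
rays that start at `p` become radii of the disc. -/
noncomputable def disc (p z : UpperHalfPlane) : ℂ :=
  ((z : ℂ) - (p : ℂ)) / ((z : ℂ) - (starRingEnd ℂ) (p : ℂ))

/-- The hyperbolic angle `∠(x, p, y)` at `p`, in `[0, π]`, between the geodesic segments `[p, x]`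
and `[p, y]` (`x ≠ p ≠ y`): the Euclidean angle between the corresponding radii of the disc model
centred at `p`. -/
noncomputable def angle (x p y : UpperHalfPlane) : ℝ :=
  InnerProductGeometry.angle (disc p x) (disc p y)

/-- `a, b, c` are the vertices of a nondegenerate triangle in positive (counterclockwise) order, that
is, `c` lies strictly to the left of the line from `a` to `b`. -/
def PosOriented (a b c : UpperHalfPlane) : Prop :=
  0 < ((starRingEnd ℂ) (disc a b) * disc a c).im

/-- `t` is the orthogonal projection of `z` on the line `ℓ`. -/
def IsOrthProj (z : UpperHalfPlane) (ℓ : Set UpperHalfPlane) (t : UpperHalfPlane) : Prop :=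
  t ∈ ℓ ∧ ∀ x ∈ ℓ, x ≠ t → angle z t x = Real.pi / 2

/-- The points `v i` are the vertices of the `n`-gon `hull (Set.range v)`, listed in cyclic order
with respect to the positive orientation: they are distinct, none of them is in the convex hull of
the others, and the polygon lies to the left of each directed side from `v i` to `v (i + 1)`. -/
structure IsPolygon (n : ℕ) (v : ZMod n → UpperHalfPlane) : Prop where
  three_le : 3 ≤ n
  injective : Function.Injective v
  extreme : ∀ i, v i ∉ hull (v '' {i}ᶜ)
  cyclic : ∀ i j, j ≠ i → j ≠ i + 1 → PosOriented (v i) (v (i + 1)) (v j)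

/-- The first end point `v (i + (n - 1) / 2)` of the side opposite to the vertex `v i`. -/
def opp₁ {n : ℕ} (v : ZMod n → UpperHalfPlane) (i : ZMod n) : UpperHalfPlane :=
  v (i + (((n - 1) / 2 : ℕ) : ZMod n))

/-- The second end point `v (i + (n + 1) / 2)` of the side opposite to the vertex `v i`. -/
def opp₂ {n : ℕ} (v : ZMod n → UpperHalfPlane) (i : ZMod n) : UpperHalfPlane :=
  v (i + (((n + 1) / 2 : ℕ) : ZMod n))

/-- The `n`-gon with vertices `v i` in positive cyclic order is an ordinary reduced polygon of
thickness `w`: `n` is odd, the minimal width is `w`, all vertices are at distance `w` from the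
opposite sides, and their orthogonal projections on the lines of these sides are in the relative
interiors of the sides. -/
structure IsOrdinaryReduced (n : ℕ) (w : ℝ) (v : ZMod n → UpperHalfPlane) : Prop where
  polygon : IsPolygon n v
  odd : Odd n
  thickness_eq : thickness (hull (Set.range v)) = w
  infDist_eq : ∀ i, Metric.infDist (v i) (seg (opp₁ v i) (opp₂ v i)) = w
  proj_mem : ∀ i, ∃ t ∈ openSeg (opp₁ v i) (opp₂ v i),
    IsOrthProj (v i) (line (opp₁ v i) (opp₂ v i)) t

noncomputable def f (w x : ℝ) : ℝ :=
  Real.arcsin (x * Real.sqrt (1 - Real.tanh w ^ 2) / (Real.tanh w - x))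

noncomputable def g (w x : ℝ) : ℝ :=
  (1 + Real.cos x - Real.sqrt ((1 + Real.cos x) ^ 2 - 4 * Real.tanh w ^ 2 * Real.cos x)) /
    (2 * Real.tanh w)

noncomputable def F (w x : ℝ) : ℝ :=
  f w (g w x)

end HypPlane

/-!
The proof computes the area of the polygon by Gauss-Bonnet and identifies the angles at the vertices.

The chart `z ↦ (re z, |z| ^ 2)` maps the upper half-plane onto the region above a parabola and
hyperbolic segments to straight segments (`mem_seg_iff`). In it, orientation is the sign of a
determinant `orient` (`posOriented_iff`), and the direction of the geodesic from `p` to `z` in the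
disc model is a positive multiple of an affine function `dir p z` of the chart coordinates of `z`.
So questions of incidence, order and adjacency of angles become linear algebra in the plane, while
lengths enter through the law of cosines (`cosh_dist_eq_cosh_mul_cosh_sub`).

Area: the region above a segment `[a, b]` has area `∫ dx / h`, where `h` is the height of a circular
arc, and this is `π` minus the two angles with the vertical (`volume_above`). A triangle is a
difference of such regions up to null sets, so its area is its angular defect (`volume_tri`). The
polygon is the union of the fan of triangles with one vertex in common, and its area is
`(n - 2) π` minus the sum of its angles (`IsPolygon.volume_hull`).

Angles: let `a = v i` and `b = v (i + (n + 1) / 2)`. The foot `s` of the perpendicular from `b` lies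
on the side `[a, v (i + 1)]`, the foot `t` of the perpendicular from `a` lies on the side that ends
in `b`, and `a, s, t, b` is a convex quadrilateral, so the perpendiculars cross in a point `p`
(`exists_crossing`). The right triangles `a t b` and `b s a` share their hypotenuse and have legs
`a t`, `b s` of length `w`. Hence the figure is symmetric, `p s = w - p a`, and trigonometry in the
right triangle `a s p` shows that the angles at `a` and `b` are `F w φ`, where `φ` is the angle at
`p` (`butterfly`). Each vertex `v i` is the point `a` for the index `i` and the point `b` for the
index `i + (n - 1) / 2`, and the perpendicular from `v i` splits the angle at `v i` into the two
corresponding parts. So the sum of the angles is `2 ∑ F w (φ i)`.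
-/

namespace HypPlane

/-! ### The chart `(re z, |z| ^ 2)` and the law of cosines -/

/-- The second coordinate `|z| ^ 2` of the chart `z ↦ (re z, |z| ^ 2)`, which maps the hyperbolic
plane onto the region above the parabola `q = x ^ 2` and hyperbolic lines to straight chords. -/
def quad (z : UpperHalfPlane) : ℝ := z.re ^ 2 + z.im ^ 2

/-- The determinant of the triple `a, b, c` in the chart `z ↦ (re z, |z| ^ 2)`. -/
def orient (a b c : UpperHalfPlane) : ℝ :=
  (b.re - a.re) * (quad c - quad a) - (c.re - a.re) * (quad b - quad a)

/-- The direction from `p` to `z`: it is affine in the coordinates `(re z, |z| ^ 2)` of `z` and a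
positive multiple of `disc p z`. -/
noncomputable def dir (p z : UpperHalfPlane) : ℂ :=
  ⟨(quad z - quad p) - 2 * p.re * (z.re - p.re), -(2 * p.im * (z.re - p.re))⟩

lemma ext_chart {z w : UpperHalfPlane} (h1 : z.re = w.re) (h2 : quad z = quad w) : z = w := by
  have h3 : z.im = w.im := by
    have hz := z.im_pos
    have hw := w.im_pos
    unfold quad at h2
    rw [h1] at h2
    nlinarith
  exact UpperHalfPlane.ext_re_im h1 h3

lemma cosh_dist_eq (z w : UpperHalfPlane) :
    2 * z.im * w.im * Real.cosh (dist z w) = quad z + quad w - 2 * z.re * w.re := by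
  have hz := z.im_pos
  have hw := w.im_pos
  rw [UpperHalfPlane.cosh_dist', quad, quad]
  field_simp
  ring

lemma dir_eq (p z : UpperHalfPlane) :
    dir p z = ((z : ℂ) - p) * (starRingEnd ℂ ((z : ℂ) - (starRingEnd ℂ) (p : ℂ))) := by
  apply Complex.ext <;> simp [dir, quad] <;> ring

lemma sub_conj_ne_zero (p z : UpperHalfPlane) : (z : ℂ) - (starRingEnd ℂ) (p : ℂ) ≠ 0 := by
  intro h
  have := congrArg Complex.im h
  simp at this
  linarith [z.im_pos, p.im_pos]

lemma exists_disc_eq_smul_dir (p z : UpperHalfPlane) : ∃ k : ℝ, 0 < k ∧ disc p z = k • dir p z := by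
  have h0 := sub_conj_ne_zero p z
  refine ⟨(Complex.normSq ((z : ℂ) - (starRingEnd ℂ) (p : ℂ)))⁻¹,
    inv_pos.mpr (Complex.normSq_pos.mpr h0), ?_⟩
  rw [dir_eq, disc, Complex.real_smul, Complex.ofReal_inv, Complex.normSq_eq_conj_mul_self]
  have h1 := (map_ne_zero (starRingEnd ℂ)).mpr h0
  field_simp

lemma angle_eq_dir (x p y : UpperHalfPlane) :
    angle x p y = InnerProductGeometry.angle (dir p x) (dir p y) := by
  obtain ⟨k, hk, h⟩ := exists_disc_eq_smul_dir p x
  obtain ⟨l, hl, h'⟩ := exists_disc_eq_smul_dir p y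
  rw [angle, h, h', InnerProductGeometry.angle_smul_left_of_pos _ _ hk,
    InnerProductGeometry.angle_smul_right_of_pos _ _ hl]

lemma im_conj_dir_mul_dir (a b c : UpperHalfPlane) :
    ((starRingEnd ℂ) (dir a b) * dir a c).im = 2 * a.im * orient a b c := by
  simp [dir, orient]; ring

lemma posOriented_iff {a b c : UpperHalfPlane} : PosOriented a b c ↔ 0 < orient a b c := by
  obtain ⟨k, hk, h⟩ := exists_disc_eq_smul_dir a b
  obtain ⟨l, hl, h'⟩ := exists_disc_eq_smul_dir a c
  have : ((starRingEnd ℂ) (disc a b) * disc a c).im = k * l * 2 * a.im * orient a b c := by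
    have := im_conj_dir_mul_dir a b c
    rw [h, h']
    simp at this ⊢
    linear_combination k * l * this
  rw [PosOriented, this]
  have : 0 < k * l * 2 * a.im := by have := a.im_pos; positivity
  exact mul_pos_iff_of_pos_left this

lemma norm_dir (p z : UpperHalfPlane) :
    ‖dir p z‖ = 2 * p.im * z.im * Real.sinh (dist p z) := by
  have hp := p.im_pos
  have hz := z.im_pos
  have hs : 0 ≤ Real.sinh (dist p z) := Real.sinh_nonneg_iff.mpr dist_nonneg
  rw [← sq_eq_sq₀ (norm_nonneg _) (by positivity), ← Complex.normSq_eq_norm_sq, mul_pow,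
    Real.sinh_sq]
  have h := cosh_dist_eq p z
  have : (2 * p.im * z.im) ^ 2 * (Real.cosh (dist p z) ^ 2 - 1) =
      (2 * p.im * z.im * Real.cosh (dist p z)) ^ 2 - (2 * p.im * z.im) ^ 2 := by ring
  rw [this, h]
  simp only [Complex.normSq_apply, dir, quad]
  ring

/-- The hyperbolic law of cosines. -/
theorem cosh_dist_eq_cosh_mul_cosh_sub (x p y : UpperHalfPlane) :
    Real.cosh (dist x y) = Real.cosh (dist p x) * Real.cosh (dist p y) -
      Real.sinh (dist p x) * Real.sinh (dist p y) * Real.cos (angle x p y) := by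
  have h := InnerProductGeometry.cos_angle_mul_norm_mul_norm (dir p x) (dir p y)
  rw [← angle_eq_dir, norm_dir, norm_dir, Complex.inner,
    mul_comm (dir p y)] at h
  have h1 := cosh_dist_eq p x
  have h2 := cosh_dist_eq p y
  have h3 := cosh_dist_eq x y
  have hp := p.im_pos
  have hx := x.im_pos
  have hy := y.im_pos
  have h4 : ((starRingEnd ℂ) (dir p x) * dir p y).re =
      (quad p + quad x - 2 * p.re * x.re) * (quad p + quad y - 2 * p.re * y.re) -
      2 * p.im ^ 2 * (quad x + quad y - 2 * x.re * y.re) := by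
    simp [dir, quad]; ring
  rw [h4, ← h1, ← h2, ← h3] at h
  have h5 : (4 * p.im ^ 2 * x.im * y.im) ≠ 0 := by positivity
  apply mul_left_cancel₀ h5
  linear_combination h

lemma dir_ne_zero {p z : UpperHalfPlane} (h : z ≠ p) : dir p z ≠ 0 := by
  intro h0
  have h1 := congrArg Complex.re h0
  have h2 := congrArg Complex.im h0
  have hp := p.im_pos
  simp [dir, hp.ne'] at h1 h2
  have h3 : z.re = p.re := by linarith
  rw [h3] at h1
  exact h (ext_chart h3 (by linarith))

/-- The direction from `p` to a point determines its position relative to `p` in the chart. -/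
lemma dir_eq_smul_iff {p b c : UpperHalfPlane} {r : ℝ} : dir p c = r • dir p b ↔
    c.re - p.re = r * (b.re - p.re) ∧ quad c - quad p = r * (quad b - quad p) := by
  have hp := p.im_pos
  rw [Complex.ext_iff]
  simp only [dir, Complex.real_smul, Complex.mul_re, Complex.mul_im, Complex.ofReal_re,
    Complex.ofReal_im]
  constructor
  · rintro ⟨h1, h2⟩
    have h3 : c.re - p.re = r * (b.re - p.re) := by
      have : (2 * p.im) ≠ 0 := by positivity
      apply mul_left_cancel₀ this
      linear_combination -h2
    refine ⟨h3, ?_⟩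
    linear_combination h1 + 2 * p.re * h3
  · rintro ⟨h1, h2⟩
    constructor
    · linear_combination h2 - 2 * p.re * h1
    · linear_combination - 2 * p.im * h1

/-- Geodesic segments are straight segments in the chart. -/
theorem mem_seg_iff {a b z : UpperHalfPlane} : z ∈ seg a b ↔ ∃ r : ℝ, 0 ≤ r ∧ r ≤ 1 ∧
    z.re = (1 - r) * a.re + r * b.re ∧ quad z = (1 - r) * quad a + r * quad b := by
  have law := cosh_dist_eq_cosh_mul_cosh_sub a z b
  by_cases hza : z = a
  · subst hza
    exact ⟨fun _ => ⟨0, by simp⟩, fun _ => by simp [seg]⟩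
  by_cases hzb : z = b
  · subst hzb
    exact ⟨fun _ => ⟨1, by simp⟩, fun _ => by simp [seg]⟩
  have hsa : 0 < Real.sinh (dist z a) := Real.sinh_pos_iff.mpr (dist_pos.mpr hza)
  have hsb : 0 < Real.sinh (dist z b) := Real.sinh_pos_iff.mpr (dist_pos.mpr hzb)
  -- by the law of cosines, distances add up exactly for a straight angle at `z`
  have key : z ∈ seg a b ↔ angle a z b = Real.pi := by
    rw [seg, Set.mem_ofPred_eq, dist_comm a z]
    constructor
    · intro h
      rw [← h, Real.cosh_add] at law
      have : Real.cos (angle a z b) = -1 := by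
        have : Real.sinh (dist z a) * Real.sinh (dist z b) ≠ 0 := by positivity
        apply mul_left_cancel₀ this
        linarith
      rw [angle, InnerProductGeometry.cos_eq_neg_one_iff_angle_eq_pi] at this
      exact this
    · intro h
      rw [h, Real.cos_pi] at law
      have : Real.cosh (dist a b) = Real.cosh (dist z a + dist z b) := by
        rw [law, Real.cosh_add]; ring
      exact (Real.cosh_strictMonoOn.injOn (Set.mem_Ici.mpr dist_nonneg)
        (Set.mem_Ici.mpr (by positivity)) this).symm
  rw [key, angle_eq_dir, InnerProductGeometry.angle_eq_pi_iff]
  constructor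
  · rintro ⟨-, r, hr, h⟩
    obtain ⟨h1, h2⟩ := dir_eq_smul_iff.mp h
    have hr' : 0 < 1 - r := by linarith
    refine ⟨1 / (1 - r), by positivity, by rw [div_le_one hr']; linarith, ?_, ?_⟩
    · field_simp; linear_combination -h1
    · field_simp; linear_combination -h2
  · rintro ⟨r, h0, h1, h2, h3⟩
    have hr0 : 0 < r := h0.lt_of_ne' (by
      rintro rfl; exact hza (ext_chart (by simpa using h2) (by simpa using h3)))
    refine ⟨dir_ne_zero (Ne.symm hza), -((1 - r) / r), ?_, ?_⟩
    · have hr1 : r < 1 := h1.lt_of_ne (by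
        rintro rfl; exact hzb (ext_chart (by simpa using h2) (by simpa using h3)))
      have : 0 < (1 - r) / r := div_pos (by linarith) hr0
      linarith
    · rw [dir_eq_smul_iff, h2, h3]
      constructor <;> field_simp <;> ring

/-! ### Angles -/

lemma angle_comm (x p y : UpperHalfPlane) : angle x p y = angle y p x :=
  InnerProductGeometry.angle_comm _ _

lemma left_mem_seg (a b : UpperHalfPlane) : a ∈ seg a b := by
  rw [seg, Set.mem_ofPred_eq, dist_self, zero_add]

lemma right_mem_seg (a b : UpperHalfPlane) : b ∈ seg a b := by
  rw [seg, Set.mem_ofPred_eq, dist_self, add_zero]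

lemma seg_comm (a b : UpperHalfPlane) : seg a b = seg b a := by
  ext z; rw [seg, seg, Set.mem_ofPred_eq, Set.mem_ofPred_eq, dist_comm a z, dist_comm z b,
    dist_comm a b, add_comm]

lemma mem_openSeg_iff {a b z : UpperHalfPlane} :
    z ∈ openSeg a b ↔ z ∈ seg a b ∧ z ≠ a ∧ z ≠ b := by
  simp [openSeg]

lemma seg_subset_line (a b : UpperHalfPlane) : seg a b ⊆ line a b := fun _ h => Or.inl h

/-- Replacing the end point of a leg by another point of the same ray keeps the angle. -/
lemma angle_eq_of_mem_seg {p b z : UpperHalfPlane} (hz : z ∈ seg p b) (hzp : z ≠ p)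
    (y : UpperHalfPlane) : angle z p y = angle b p y := by
  obtain ⟨r, h0, -, h1, h2⟩ := mem_seg_iff.mp hz
  have hr : 0 < r := h0.lt_of_ne' (by
    rintro rfl; exact hzp (ext_chart (by simpa using h1) (by simpa using h2)))
  have : dir p z = r • dir p b :=
    dir_eq_smul_iff.mpr ⟨by linear_combination h1, by linear_combination h2⟩
  rw [angle_eq_dir, angle_eq_dir, this, InnerProductGeometry.angle_smul_left_of_pos _ _ hr]

lemma exists_dir_eq_neg_smul {a b z : UpperHalfPlane} (hz : z ∈ openSeg a b) :
    ∃ r : ℝ, 0 < r ∧ dir z a = -(r • dir z b) := by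
  obtain ⟨hz, hza, hzb⟩ := mem_openSeg_iff.mp hz
  obtain ⟨r, h0, h1, h2, h3⟩ := mem_seg_iff.mp hz
  have hr1 : r < 1 := h1.lt_of_ne (by
    rintro rfl; exact hzb (ext_chart (by simpa using h2) (by simpa using h3)))
  have h1r : 0 < 1 - r := by linarith
  have hr : 0 < r := h0.lt_of_ne' (by
    rintro rfl; exact hza (ext_chart (by simpa using h2) (by simpa using h3)))
  refine ⟨r / (1 - r), by positivity, ?_⟩
  rw [← neg_smul, dir_eq_smul_iff]
  constructor
  · field_simp; linear_combination -h2
  · field_simp; linear_combination -h3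

/-- Vertical angles are equal. -/
lemma angle_vertical {a b s t z : UpperHalfPlane} (hz : z ∈ openSeg a t) (hz' : z ∈ openSeg b s) :
    angle a z s = angle t z b := by
  obtain ⟨k, hk, h⟩ := exists_dir_eq_neg_smul hz
  obtain ⟨l, hl, h'⟩ := exists_dir_eq_neg_smul hz'
  rw [angle_eq_dir, angle_eq_dir, h, h', InnerProductGeometry.angle_neg_right,
    InnerProductGeometry.angle_neg_left, InnerProductGeometry.angle_smul_left_of_pos _ _ hk,
    InnerProductGeometry.angle_smul_right_of_pos _ _ hl]

/-- Positively oriented angles are differences of arguments of directions, up to full turns. -/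
lemma exists_angle_eq {p b c : UpperHalfPlane} (h : 0 < orient p b c) :
    0 < angle b p c ∧ angle b p c < Real.pi ∧
    ∃ k : ℤ, angle b p c - ((dir p c).arg - (dir p b).arg) = 2 * Real.pi * k := by
  have him : 0 < ((starRingEnd ℂ) (dir p b) * dir p c).im := by
    rw [im_conj_dir_mul_dir]; have := p.im_pos; positivity
  have hb : dir p b ≠ 0 := by intro h0; simp [h0] at him
  have hc : dir p c ≠ 0 := by intro h0; simp [h0] at him
  have hcb := (map_ne_zero (starRingEnd ℂ)).mpr hb
  have h1 : angle b p c = ((starRingEnd ℂ) (dir p b) * dir p c).arg := by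
    rw [angle_comm, angle_eq_dir, Complex.angle_eq_abs_arg hc hb]
    have : dir p c / dir p b = ((Complex.normSq (dir p b))⁻¹ : ℝ) *
        ((starRingEnd ℂ) (dir p b) * dir p c) := by
      rw [Complex.ofReal_inv, Complex.normSq_eq_conj_mul_self]
      field_simp
    rw [this, Complex.arg_real_mul _ (inv_pos.mpr (Complex.normSq_pos.mpr hb)), abs_of_nonneg]
    exact Complex.arg_nonneg_iff.mpr him.le
  refine ⟨?_, ?_, ?_⟩
  · rw [h1]
    refine (Complex.arg_nonneg_iff.mpr him.le).lt_of_ne' fun h0 => ?_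
    exact him.ne' (Complex.arg_eq_zero_iff.mp h0).2
  · rw [h1]
    refine (Complex.arg_le_pi _).lt_of_ne fun h0 => ?_
    exact him.ne' (Complex.arg_eq_pi_iff.mp h0).2
  · rw [← Real.Angle.angle_eq_iff_two_pi_dvd_sub, h1, Complex.arg_mul_coe_angle hcb hc,
      Complex.arg_conj_coe_angle, Real.Angle.coe_sub]
    abel

lemma int_eq_zero_of_abs_lt {k : ℤ} (h : |2 * Real.pi * k| < 2 * Real.pi) : k = 0 := by
  have hpi := Real.pi_pos
  rw [abs_mul, abs_of_pos (by positivity)] at h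
  have : |(k : ℝ)| < 1 := by
    by_contra! h1
    nlinarith
  exact_mod_cast Int.abs_lt_one_iff.mp (by exact_mod_cast this)

/-- Adjacent angles add up as long as the whole angle is less than `π`. -/
theorem angle_add {p b c d : UpperHalfPlane} (hbc : 0 < orient p b c) (hcd : 0 < orient p c d)
    (hbd : 0 < orient p b d) : angle b p d = angle b p c + angle c p d := by
  obtain ⟨h1, h1', k1, hk1⟩ := exists_angle_eq hbc
  obtain ⟨h2, h2', k2, hk2⟩ := exists_angle_eq hcd
  obtain ⟨h3, h3', k3, hk3⟩ := exists_angle_eq hbd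
  have h : angle b p d - (angle b p c + angle c p d) = 2 * Real.pi * ((k3 - k1 - k2 : ℤ) : ℝ) := by
    push_cast
    linear_combination hk3 - hk1 - hk2
  have h0 : k3 - k1 - k2 = 0 := by
    apply int_eq_zero_of_abs_lt
    rw [← h, abs_lt]
    constructor <;> linarith
  rw [h0] at h
  simp at h
  linarith

/-! ### Right triangles and the crossing of two equal perpendiculars -/

/-- The hyperbolic theorem of Pythagoras. -/
lemma cosh_dist_of_right_angle {a s p : UpperHalfPlane} (h : angle a s p = Real.pi / 2) :
    Real.cosh (dist a p) = Real.cosh (dist s a) * Real.cosh (dist s p) := by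
  rw [cosh_dist_eq_cosh_mul_cosh_sub a s p, h, Real.cos_pi_div_two]; ring

/-- In a right triangle with hypotenuse `x`, legs `y`, `e`, the angle `θ` opposite to `y` is a
function of the angle `φ` between `x` and `y` and of the sum `x + y`. -/
lemma F_eq_of_right_triangle {x y e φ θ : ℝ} (hx : 0 < x) (hy : 0 < y) (he : 0 < e)
    (h1 : Real.cosh x = Real.cosh e * Real.cosh y)
    (h2 : Real.cosh e = Real.cosh x * Real.cosh y - Real.sinh x * Real.sinh y * Real.cos φ)
    (h3 : Real.cosh y = Real.cosh x * Real.cosh e - Real.sinh x * Real.sinh e * Real.cos θ)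
    (h0 : 0 ≤ θ) (hpi : θ ≤ Real.pi) : F (x + y) φ = θ := by
  have sx : 0 < Real.sinh x := Real.sinh_pos_iff.mpr hx
  have sy : 0 < Real.sinh y := Real.sinh_pos_iff.mpr hy
  have se : 0 < Real.sinh e := Real.sinh_pos_iff.mpr he
  have cx : 0 < Real.cosh x := Real.cosh_pos x
  have cy : 0 < Real.cosh y := Real.cosh_pos y
  have ce : 0 < Real.cosh e := Real.cosh_pos e
  have qx := Real.cosh_sq x
  have qy := Real.cosh_sq y
  have qe := Real.cosh_sq e
  have cw : 0 < Real.cosh (x + y) := Real.cosh_pos _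
  have sw : 0 < Real.sinh (x + y) := Real.sinh_pos_iff.mpr (by linarith)
  have hφ : Real.cos φ = Real.tanh y / Real.tanh x := by
    have hkey : Real.cos φ * Real.sinh x * Real.cosh y = Real.sinh y * Real.cosh x := by
      apply mul_left_cancel₀ sy.ne'
      linear_combination Real.cosh y * h2 + Real.cosh x * qy + h1
    rw [Real.tanh_eq_sinh_div_cosh, Real.tanh_eq_sinh_div_cosh]
    field_simp
    linear_combination hkey
  have hTx : 0 < Real.tanh x := by rw [Real.tanh_eq_sinh_div_cosh]; positivity
  have hTy : 0 < Real.tanh y := by rw [Real.tanh_eq_sinh_div_cosh]; positivity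
  have hTx1 : Real.tanh x < 1 := Real.tanh_lt_one x
  have hTy1 : Real.tanh y < 1 := Real.tanh_lt_one y
  have hW : Real.tanh (x + y) = (Real.tanh x + Real.tanh y) / (1 + Real.tanh x * Real.tanh y) := by
    simp only [Real.tanh_eq_sinh_div_cosh, Real.sinh_add, Real.cosh_add]
    field_simp
  -- in terms of `tanh x`, `tanh y` the discriminant in `g` is a square
  have hg : g (x + y) φ = Real.tanh y := by
    have hxy : Real.tanh x * Real.tanh y < 1 := by nlinarith
    unfold g
    have hsq : (1 + Real.cos φ) ^ 2 - 4 * Real.tanh (x + y) ^ 2 * Real.cos φ =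
        ((1 + Real.cos φ) * (1 - Real.tanh x * Real.tanh y) /
          (1 + Real.tanh x * Real.tanh y)) ^ 2 := by
      rw [hW, hφ]
      field_simp
      ring
    rw [hsq, Real.sqrt_sq, hW, hφ]
    · field_simp
      ring
    · rw [hφ]
      have : 0 < 1 - Real.tanh x * Real.tanh y := by linarith
      positivity
  have hsqrt : Real.sqrt (1 - Real.tanh (x + y) ^ 2) = 1 / Real.cosh (x + y) := by
    rw [Real.sqrt_eq_iff_eq_sq, Real.tanh_eq_sinh_div_cosh]
    · have := Real.cosh_sq (x + y)
      field_simp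
      linarith
    · have := Real.tanh_sq_lt_one (x + y)
      linarith
    · positivity
  have hsub : Real.tanh (x + y) - Real.tanh y =
      Real.sinh x / (Real.cosh (x + y) * Real.cosh y) := by
    rw [Real.tanh_eq_sinh_div_cosh, Real.tanh_eq_sinh_div_cosh]
    have : Real.sinh x = Real.sinh (x + y) * Real.cosh y - Real.cosh (x + y) * Real.sinh y := by
      rw [← Real.sinh_sub]; congr 1; ring
    rw [this]
    field_simp
  have hcos : Real.cos θ * Real.sinh x = Real.cosh y * Real.sinh e := by
    apply mul_left_cancel₀ se.ne'
    linear_combination h3 + Real.cosh e * h1 + Real.cosh y * qe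
  have hcos0 : 0 ≤ Real.cos θ := by
    by_contra! hneg
    nlinarith [mul_pos cy se]
  have hθ : θ ≤ Real.pi / 2 := by
    by_contra! hlt
    have := Real.cos_neg_of_pi_div_two_lt_of_lt hlt (by linarith [Real.pi_pos])
    linarith
  have hsin : Real.sin θ = Real.sinh y / Real.sinh x := by
    have hs0 : 0 ≤ Real.sin θ := Real.sin_nonneg_of_nonneg_of_le_pi h0 hpi
    rw [eq_div_iff sx.ne', ← sq_eq_sq₀ (by positivity) sy.le, mul_pow, Real.sin_sq]
    have : (Real.cos θ * Real.sinh x) ^ 2 = (Real.cosh y * Real.sinh e) ^ 2 := by rw [hcos]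
    linear_combination -this - qx + (Real.cosh x + Real.cosh e * Real.cosh y) * h1 +
      Real.cosh y ^ 2 * qe + qy
  have hf : Real.tanh y * Real.sqrt (1 - Real.tanh (x + y) ^ 2) /
      (Real.tanh (x + y) - Real.tanh y) = Real.sin θ := by
    rw [hsqrt, hsub, hsin, Real.tanh_eq_sinh_div_cosh]
    field_simp
  rw [F, hg, f, hf, Real.arcsin_sin (by linarith [Real.pi_pos]) hθ]

/-- Two right triangles `a t b` and `b s a` with the common hypotenuse `a b` and equal legs
`a t`, `b s` of length `w`: if the legs meet in an interior point `p`, the figure is symmetric, and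
the angles at `a` and `b` are `F w` of the angle at `p`. -/
theorem butterfly {a b s t p : UpperHalfPlane} {w : ℝ} (hat : dist a t = w) (hbs : dist b s = w)
    (ht : angle a t b = Real.pi / 2) (hs : angle b s a = Real.pi / 2)
    (hp : p ∈ openSeg a t) (hp' : p ∈ openSeg b s) (hsa : s ≠ a) :
    F w (angle a p s) = angle s a t ∧ F w (angle a p s) = angle t b s := by
  obtain ⟨hpat, hpa, hpt⟩ := mem_openSeg_iff.mp hp
  obtain ⟨hpbs, hpb, hps⟩ := mem_openSeg_iff.mp hp'
  have e1 : dist t p = w - dist a p := by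
    have : dist a p + dist p t = dist a t := hpat
    rw [dist_comm t p]; linarith
  have e2 : dist s p = w - dist b p := by
    have : dist b p + dist p s = dist b s := hpbs
    rw [dist_comm s p]; linarith
  have hs' : angle a s p = Real.pi / 2 := by
    rw [angle_comm, angle_eq_of_mem_seg (by rwa [seg_comm] at hpbs) hps, hs]
  have ht' : angle b t p = Real.pi / 2 := by
    rw [angle_comm, angle_eq_of_mem_seg (by rwa [seg_comm] at hpat) hpt, ht]
  have c1 := cosh_dist_of_right_angle hs'
  have c2 := cosh_dist_of_right_angle ht'
  have c3 := cosh_dist_of_right_angle hs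
  have c4 := cosh_dist_of_right_angle ht
  have d1 : 0 < dist s a := dist_pos.mpr hsa
  have hap : 0 < dist a p := dist_pos.mpr (Ne.symm hpa)
  have hbp : 0 < dist b p := dist_pos.mpr (Ne.symm hpb)
  have hsp : 0 < dist s p := dist_pos.mpr (Ne.symm hps)
  have htp : 0 < dist t p := dist_pos.mpr (Ne.symm hpt)
  have cosh_inj : ∀ {x y : ℝ}, 0 ≤ x → 0 ≤ y → Real.cosh x = Real.cosh y → x = y :=
    fun hx hy h => Real.cosh_strictMonoOn.injOn (Set.mem_Ici.mpr hx) (Set.mem_Ici.mpr hy) h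
  -- the legs on the common side are equal
  have e3 : dist s a = dist t b := by
    apply cosh_inj dist_nonneg dist_nonneg
    rw [dist_comm b a, dist_comm s b, hbs] at c3
    rw [dist_comm t a, hat] at c4
    have hw := (Real.cosh_pos w).ne'
    apply mul_left_cancel₀ hw
    linarith
  -- `cosh x cosh (w - x)` has the same value at `x = dist a p` and at `x = dist b p`
  have hab : dist a p = dist b p := by
    rw [e2] at c1
    rw [← e3, e1] at c2
    have h1 : Real.cosh (dist a p) * Real.cosh (w - dist a p) =
        Real.cosh (dist b p) * Real.cosh (w - dist b p) := by rw [c1, c2]; ring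
    have key : ∀ x : ℝ, Real.cosh x * Real.cosh (w - x) =
        (Real.cosh w + Real.cosh (2 * x - w)) / 2 := by
      intro x
      have r1 := Real.cosh_add x (w - x)
      have r2 := Real.cosh_sub x (w - x)
      rw [add_sub_cancel] at r1
      rw [show x - (w - x) = 2 * x - w by ring] at r2
      linarith
    rw [key, key] at h1
    have h2 : |2 * dist a p - w| = |2 * dist b p - w| := by
      apply cosh_inj (abs_nonneg _) (abs_nonneg _)
      rw [Real.cosh_abs, Real.cosh_abs]; linarith
    rcases abs_eq_abs.mp h2 with h | h
    · linarith
    · -- `dist a p + dist b p = w` would force `s = a`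
      exfalso
      have h3 : w - dist b p = dist a p := by linarith
      rw [h3] at c1
      have := Real.one_lt_cosh.mpr d1.ne'
      nlinarith [Real.cosh_pos (dist a p)]
  have hw : w = dist a p + dist s p := by rw [e2, hab]; ring
  have hw' : w = dist b p + dist t p := by rw [e1, hab]; ring
  constructor
  · rw [angle_comm s a t, ← angle_eq_of_mem_seg hpat hpa, hw]
    refine F_eq_of_right_triangle hap hsp d1 c1 ?_ ?_ (InnerProductGeometry.angle_nonneg _ _)
      (InnerProductGeometry.angle_le_pi _ _)
    · rw [dist_comm s a, dist_comm s p, dist_comm a p]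
      exact cosh_dist_eq_cosh_mul_cosh_sub a p s
    · rw [dist_comm s a, dist_comm s p]
      exact cosh_dist_eq_cosh_mul_cosh_sub p a s
  · rw [angle_vertical hp hp', angle_comm t p b, angle_comm t b s, ← angle_eq_of_mem_seg hpbs hpb,
      hw']
    refine F_eq_of_right_triangle hbp htp (e3 ▸ d1) c2 ?_ ?_ (InnerProductGeometry.angle_nonneg _ _)
      (InnerProductGeometry.angle_le_pi _ _)
    · rw [dist_comm t b, dist_comm t p, dist_comm b p]
      exact cosh_dist_eq_cosh_mul_cosh_sub b p t
    · rw [dist_comm t b, dist_comm t p]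
      exact cosh_dist_eq_cosh_mul_cosh_sub p b t

/-! ### Null sets and the area above a segment -/

open MeasureTheory

lemma continuous_quad : Continuous quad := by
  unfold quad
  have h1 := UpperHalfPlane.continuous_re
  have h2 := UpperHalfPlane.continuous_im
  fun_prop

lemma continuous_orient (a b : UpperHalfPlane) : Continuous (orient a b) := by
  unfold orient
  have h1 := UpperHalfPlane.continuous_re
  have h2 := continuous_quad
  fun_prop

/-- A set that meets almost every vertical line in at most one point is a null set. -/
lemma volume_eq_zero_of_subsingleton_fibres {s : Set UpperHalfPlane} (hs : MeasurableSet s) (x₀ : ℝ)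
    (h : ∀ z ∈ s, ∀ w ∈ s, z.re = w.re → z.re ≠ x₀ → z = w) : volume s = 0 := by
  rw [UpperHalfPlane.volume_eq_lintegral]
  apply setLIntegral_measure_zero
  have hm := UpperHalfPlane.measurableEmbedding_coe.measurableSet_image.mpr hs
  rw [← (Complex.volume_preserving_equiv_real_prod.symm).measure_preimage hm.nullMeasurableSet,
    Measure.volume_eq_prod, Measure.measure_prod_null
      (Complex.measurableEquivRealProd.symm.measurable hm)]
  have : ∀ᵐ x : ℝ, x ≠ x₀ := by simp [ae_iff]
  filter_upwards [this] with x hx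
  apply Set.Subsingleton.measure_zero
  rintro y ⟨z, hz, hzy⟩ y' ⟨w, hw, hwy⟩
  have e1 : (z : ℂ) = ⟨x, y⟩ := hzy
  have e2 : (w : ℂ) = ⟨x, y'⟩ := hwy
  have r1 : z.re = x := congrArg Complex.re e1
  have r2 : w.re = x := congrArg Complex.re e2
  have i1 : z.im = y := congrArg Complex.im e1
  have i2 : w.im = y' := congrArg Complex.im e2
  rw [← i1, ← i2, h z hz w hw (r1.trans r2.symm) (r1 ▸ hx)]

lemma volume_re_eq (x₀ : ℝ) : volume {z : UpperHalfPlane | z.re = x₀} = 0 :=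
  volume_eq_zero_of_subsingleton_fibres
    (isClosed_singleton.preimage UpperHalfPlane.continuous_re).measurableSet x₀
    fun _ hz _ _ _ h => absurd hz h

/-- Lines are null sets. -/
lemma volume_orient_eq_zero {a b : UpperHalfPlane} (hab : a ≠ b) :
    volume {z : UpperHalfPlane | orient a b z = 0} = 0 := by
  refine volume_eq_zero_of_subsingleton_fibres
    (isClosed_singleton.preimage (continuous_orient a b)).measurableSet a.re fun z hz w hw h hz' => ?_
  have hz : orient a b z = 0 := hz
  have hw : orient a b w = 0 := hw
  refine ext_chart h ?_
  unfold orient at hz hw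
  rw [← h] at hw
  have h1 : (b.re - a.re) * (quad z - quad w) = 0 := by linear_combination hz - hw
  rcases mul_eq_zero.mp h1 with h2 | h2
  · exfalso
    rw [h2, zero_mul, zero_sub, neg_eq_zero] at hz
    rcases mul_eq_zero.mp hz with h3 | h3
    · exact hz' (by linarith)
    · exact hab (ext_chart (by linarith) (by linarith))
  · linarith

lemma lintegral_Ici_one_div_sq {c : ℝ} (hc : 0 < c) :
    ∫⁻ y in Set.Ici c, ((1 / ‖y‖₊) ^ 2 : NNReal) = ENNReal.ofReal (1 / c) := by
  have h1 := integral_Ioi_rpow_of_lt (a := -2) (by norm_num) hc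
  have h2 := integrableOn_Ioi_rpow_of_lt (a := -2) (by norm_num) hc
  have h3 : (-c ^ ((-2 : ℝ) + 1) / (-2 + 1)) = 1 / c := by
    have : (-2 : ℝ) + 1 = -1 := by norm_num
    rw [this, Real.rpow_neg_one]; ring
  rw [← h3, ← h1, ofReal_integral_eq_lintegral_ofReal h2, setLIntegral_congr Ioi_ae_eq_Ici.symm]
  · refine setLIntegral_congr_fun measurableSet_Ioi fun y hy => ?_
    have hy : 0 < y := hc.trans hy
    rw [ENNReal.ofReal, ENNReal.coe_inj]
    apply NNReal.eq
    rw [Real.coe_toNNReal _ (by positivity), Real.rpow_neg hy.le]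
    simp [abs_of_pos hy]
  · filter_upwards [ae_restrict_mem measurableSet_Ioi] with y hy
    have hy : 0 < y := hc.trans hy
    positivity

/-- The hyperbolic area above the graph of a function. -/
lemma volume_above_graph {A B : ℝ} {h : ℝ → ℝ} (hm : Measurable h)
    (hpos : ∀ x ∈ Set.Ioc A B, 0 < h x) :
    volume {z : UpperHalfPlane | z.re ∈ Set.Ioc A B ∧ h z.re ≤ z.im} =
      ∫⁻ x in Set.Ioc A B, ENNReal.ofReal (1 / h x) := by
  set S : Set (ℝ × ℝ) := {q | q.1 ∈ Set.Ioc A B ∧ h q.1 ≤ q.2} with hS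
  have hSm : MeasurableSet S :=
    (measurable_fst measurableSet_Ioc).inter
      (measurableSet_le (hm.comp measurable_fst) measurable_snd)
  have himg : ((↑) : UpperHalfPlane → ℂ) ''
      {z : UpperHalfPlane | z.re ∈ Set.Ioc A B ∧ h z.re ≤ z.im} =
      Complex.measurableEquivRealProd ⁻¹' S := by
    ext z
    constructor
    · rintro ⟨w, hw, rfl⟩
      exact hw
    · intro hz
      have hz : z.re ∈ Set.Ioc A B ∧ h z.re ≤ z.im := hz
      exact ⟨⟨z, (hpos _ hz.1).trans_le hz.2⟩, hz, rfl⟩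
  rw [UpperHalfPlane.volume_eq_lintegral, himg]
  refine (Complex.volume_preserving_equiv_real_prod.setLIntegral_comp_preimage_emb
      Complex.measurableEquivRealProd.measurableEmbedding
      (fun q : ℝ × ℝ => (((1 / ‖q.2‖₊) ^ 2 : NNReal) : ENNReal)) S).trans ?_
  rw [Measure.volume_eq_prod, ← lintegral_indicator hSm, lintegral_prod,
    ← lintegral_indicator measurableSet_Ioc]
  · congr 1
    ext x
    by_cases hx : x ∈ Set.Ioc A B
    · rw [Set.indicator_of_mem hx, ← lintegral_Ici_one_div_sq (hpos x hx),
        ← lintegral_indicator measurableSet_Ici]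
      congr 1
      ext y
      have : (x, y) ∈ S ↔ y ∈ Set.Ici (h x) := by simp [hS, hx.1, hx.2]
      by_cases hy : y ∈ Set.Ici (h x)
      · rw [Set.indicator_of_mem hy, Set.indicator_of_mem (this.mpr hy)]
      · rw [Set.indicator_of_notMem hy, Set.indicator_of_notMem (fun h' => hy (this.mp h'))]
    · rw [Set.indicator_of_notMem hx]
      have : ∀ y, (x, y) ∉ S := fun y hy => hx hy.1
      simp [Set.indicator_of_notMem, this]
  · apply Measurable.aemeasurable
    apply Measurable.indicator _ hSm
    fun_prop

lemma integral_one_div_sqrt {A B c r : ℝ} (hAB : A ≤ B) (hr : 0 < r)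
    (hpos : ∀ x ∈ Set.Icc A B, 0 < r ^ 2 - (x - c) ^ 2) :
    IntegrableOn (fun x => 1 / Real.sqrt (r ^ 2 - (x - c) ^ 2)) (Set.Ioc A B) ∧
    ∫ x in Set.Ioc A B, 1 / Real.sqrt (r ^ 2 - (x - c) ^ 2) =
      Real.arcsin ((B - c) / r) - Real.arcsin ((A - c) / r) := by
  have hu : Set.uIcc A B = Set.Icc A B := Set.uIcc_of_le hAB
  have hcont : ContinuousOn (fun x => 1 / Real.sqrt (r ^ 2 - (x - c) ^ 2)) (Set.uIcc A B) := by
    rw [hu]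
    refine ContinuousOn.div continuousOn_const ?_ fun x hx => (Real.sqrt_pos.mpr (hpos x hx)).ne'
    fun_prop
  have hint := hcont.intervalIntegrable (μ := volume)
  refine ⟨(intervalIntegrable_iff_integrableOn_Ioc_of_le hAB).mp hint, ?_⟩
  rw [← intervalIntegral.integral_of_le hAB]
  refine intervalIntegral.integral_eq_sub_of_hasDerivAt
    (f := fun x => Real.arcsin ((x - c) / r)) (fun x hx => ?_) hint
  rw [hu] at hx
  have h1 := hpos x hx
  have hlt : ((x - c) / r) ^ 2 < 1 := by
    rw [div_pow, div_lt_one (by positivity)]; linarith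
  have hne1 : (x - c) / r ≠ -1 := by intro h; rw [h] at hlt; norm_num at hlt
  have hne2 : (x - c) / r ≠ 1 := by intro h; rw [h] at hlt; norm_num at hlt
  have h2 := (Real.hasDerivAt_arcsin hne1 hne2).comp x (((hasDerivAt_id x).sub_const c).div_const r)
  convert! h2 using 1
  have h3 : r ^ 2 - (x - c) ^ 2 = r ^ 2 * (1 - ((x - c) / r) ^ 2) := by field_simp
  rw [h3, Real.sqrt_mul (by positivity), Real.sqrt_sq hr.le]
  have : 0 < Real.sqrt (1 - ((x - c) / r) ^ 2) := Real.sqrt_pos.mpr (by linarith)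
  field_simp

/-- The region above the geodesic segment `[a, b]`, where `a` is to the left of `b`. Half-open
intervals make the regions of consecutive segments disjoint. -/
def above (a b : UpperHalfPlane) : Set UpperHalfPlane :=
  {z | z.re ∈ Set.Ioc a.re b.re ∧ 0 ≤ orient a b z}

lemma measurableSet_above (a b : UpperHalfPlane) : MeasurableSet (above a b) :=
  (UpperHalfPlane.continuous_re.measurable measurableSet_Ioc).inter
    ((continuous_orient a b).measurable measurableSet_Ici)

/-- The lexicographic order of `(re, im)`. Vertical segments run upwards in it, and the formula for the
area of `above a b` remains true for them, with the value `0`. -/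
def LexLt (a b : UpperHalfPlane) : Prop := a.re < b.re ∨ a.re = b.re ∧ a.im < b.im

lemma quad_lt {a b : UpperHalfPlane} (h1 : a.re = b.re) (h2 : a.im < b.im) : quad a < quad b := by
  unfold quad
  rw [h1]
  have := a.im_pos
  nlinarith

lemma LexLt.re_le {a b : UpperHalfPlane} (h : LexLt a b) : a.re ≤ b.re := by
  rcases h with h | h
  · exact h.le
  · exact h.1.le

/-- The vertical direction has argument `0` in the disc model, so segments that leave their left end
point to the right or straight up have argument in `(-π, 0]`. -/
lemma arg_dir_of_lexLt {a b : UpperHalfPlane} (h : LexLt a b) :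
    (dir a b).arg ≤ 0 ∧ -Real.pi < (dir a b).arg := by
  refine ⟨?_, Complex.neg_pi_lt_arg _⟩
  have ha := a.im_pos
  rcases h with h | ⟨h1, h2⟩
  · refine (Complex.arg_neg_iff.mpr ?_).le
    simp only [dir]
    nlinarith
  · have := quad_lt h1 h2
    refine (Complex.arg_eq_zero_iff.mpr ?_).le
    simp [dir, h1]
    linarith

/-- Segments leave their right end point to the left or straight down. -/
lemma arg_dir_of_lexLt' {a b : UpperHalfPlane} (h : LexLt a b) :
    0 < (dir b a).arg ∧ (dir b a).arg ≤ Real.pi := by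
  refine ⟨?_, Complex.arg_le_pi _⟩
  have hb := b.im_pos
  rcases h with h | ⟨h1, h2⟩
  · have him : 0 < (dir b a).im := by
      simp only [dir]
      nlinarith
    refine (Complex.arg_nonneg_iff.mpr him.le).lt_of_ne' fun h0 => ?_
    exact him.ne' (Complex.arg_eq_zero_iff.mp h0).2
  · have := quad_lt h1 h2
    have : (dir b a).arg = Real.pi := by
      rw [Complex.arg_eq_pi_iff]
      simp [dir, h1]
      linarith
    rw [this]
    exact Real.pi_pos

/-- The region above `[a, b]` is a triangle with one ideal vertex; its area is `π` minus the sum of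
the angles at `a` and `b`. -/
theorem volume_above {a b : UpperHalfPlane} (h : LexLt a b) :
    volume (above a b) ≠ ⊤ ∧
    volume.real (above a b) = Real.pi + (dir a b).arg - (dir b a).arg := by
  rcases h with h | ⟨h1, h2⟩
  swap
  · have he : above a b = ∅ := by
      simp [above, h1]
    have hq := quad_lt h1 h2
    have e1 : (dir a b).arg = 0 := by
      rw [Complex.arg_eq_zero_iff]
      simp [dir, h1]
      linarith
    have e2 : (dir b a).arg = Real.pi := by
      rw [Complex.arg_eq_pi_iff]
      simp [dir, h1]
      linarith
    rw [he, e1, e2]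
    simp
  have hΔ : 0 < b.re - a.re := by linarith
  have ha := a.im_pos
  have hb := b.im_pos
  -- centre and radius of the circle through `a` and `b`
  set c : ℝ := (quad b - quad a) / (2 * (b.re - a.re)) with hc
  have hc' : quad b - quad a = 2 * c * (b.re - a.re) := by rw [hc]; field_simp
  set r : ℝ := Real.sqrt ((a.re - c) ^ 2 + a.im ^ 2) with hr
  have hr2 : r ^ 2 = (a.re - c) ^ 2 + a.im ^ 2 := Real.sq_sqrt (by positivity)
  have hr2' : r ^ 2 = (b.re - c) ^ 2 + b.im ^ 2 := by
    rw [hr2]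
    unfold quad at hc'
    linear_combination -hc'
  have hrpos : 0 < r := Real.sqrt_pos.mpr (by positivity)
  have hpos : ∀ x ∈ Set.Icc a.re b.re, 0 < r ^ 2 - (x - c) ^ 2 := by
    rintro x ⟨hx1, hx2⟩
    have key : (b.re - a.re) * (r ^ 2 - (x - c) ^ 2) = (b.re - x) * a.im ^ 2 +
        (x - a.re) * b.im ^ 2 + (b.re - a.re) * ((x - a.re) * (b.re - x)) := by
      linear_combination (b.re - x) * hr2 + (x - a.re) * hr2'
    have k1 : 0 ≤ (x - a.re) * (b.re - x) := mul_nonneg (by linarith) (by linarith)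
    have k2 : 0 < (b.re - x) * a.im ^ 2 + (x - a.re) * b.im ^ 2 := by
      rcases hx1.eq_or_lt with rfl | hx1
      · have : 0 < b.im ^ 2 := by positivity
        have : 0 < a.im ^ 2 := by positivity
        nlinarith
      · have : 0 < (x - a.re) * b.im ^ 2 := mul_pos (by linarith) (by positivity)
        have : 0 ≤ (b.re - x) * a.im ^ 2 := mul_nonneg (by linarith) (by positivity)
        linarith
    have : 0 < (b.re - a.re) * (r ^ 2 - (x - c) ^ 2) := by
      rw [key]; positivity
    exact pos_of_mul_pos_right this hΔ.le
  have hset : above a b = {z : UpperHalfPlane | z.re ∈ Set.Ioc a.re b.re ∧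
      Real.sqrt (r ^ 2 - (z.re - c) ^ 2) ≤ z.im} := by
    ext z
    simp only [above, Set.mem_ofPred_eq]
    refine and_congr_right fun hz => ?_
    rw [Real.sqrt_le_left z.im_pos.le]
    have : orient a b z = (b.re - a.re) * (z.im ^ 2 - (r ^ 2 - (z.re - c) ^ 2)) := by
      rw [orient, hc', hr2, quad, quad]; ring
    rw [this, mul_nonneg_iff_of_pos_left hΔ, sub_nonneg]
  have hvol := volume_above_graph (A := a.re) (B := b.re)
    (h := fun x => Real.sqrt (r ^ 2 - (x - c) ^ 2)) (by fun_prop)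
    (fun x hx => Real.sqrt_pos.mpr (hpos x ⟨hx.1.le, hx.2⟩))
  obtain ⟨hi, hI⟩ := integral_one_div_sqrt h.le hrpos hpos
  have hnn : ∀ x : ℝ, 0 ≤ 1 / Real.sqrt (r ^ 2 - (x - c) ^ 2) := fun x => by positivity
  rw [← ofReal_integral_eq_lintegral_ofReal hi (Filter.Eventually.of_forall hnn), hI, ← hset]
    at hvol
  have hnn' := setIntegral_nonneg (μ := volume) (measurableSet_Ioc (a := a.re) (b := b.re))
    (fun x _ => hnn x)
  rw [hI] at hnn'
  refine ⟨by rw [hvol]; exact ENNReal.ofReal_ne_top, ?_⟩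
  rw [measureReal_def, hvol, ENNReal.toReal_ofReal hnn']
  have arg_eq : ∀ z : UpperHalfPlane, r ^ 2 = (z.re - c) ^ 2 + z.im ^ 2 →
      ((z : ℂ) - c).arg = Real.arccos ((z.re - c) / r) := by
    intro z hz
    have hne : (z : ℂ) - c ≠ 0 := by
      intro h0
      have := congrArg Complex.im h0
      exact z.im_ne_zero (by simpa using this)
    rw [Complex.arg_of_im_nonneg_of_ne_zero (by simpa using z.im_pos.le) hne]
    have : ‖(z : ℂ) - c‖ = r := by
      rw [← sq_eq_sq₀ (norm_nonneg _) hrpos.le, ← Complex.normSq_eq_norm_sq, hz,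
        Complex.normSq_apply]
      simp
      ring
    rw [this]
    simp
  have d1 : dir a b = ((2 * (b.re - a.re) : ℝ) : ℂ) * -((a : ℂ) - c) := by
    apply Complex.ext
    · simp [dir]
      linear_combination hc'
    · simp [dir]
      ring
  have d2 : dir b a = ((2 * (b.re - a.re) : ℝ) : ℂ) * ((b : ℂ) - c) := by
    apply Complex.ext
    · simp [dir]
      linear_combination -hc'
    · simp [dir]
      ring
  rw [d1, d2, Complex.arg_real_mul _ (by positivity), Complex.arg_real_mul _ (by positivity),
    Complex.arg_neg_eq_arg_sub_pi_of_im_pos (by simpa using ha), arg_eq a hr2, arg_eq b hr2',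
    Real.arccos, Real.arccos]
  ring

/-! ### The area of a triangle -/

lemma orient_rotate (a b c : UpperHalfPlane) : orient b c a = orient a b c := by
  unfold orient; ring

lemma orient_swap (a b c : UpperHalfPlane) : orient b a c = -orient a b c := by
  unfold orient; ring

lemma orient_self_right (a b : UpperHalfPlane) : orient a b b = 0 := by unfold orient; ring

lemma orient_self_left (a b : UpperHalfPlane) : orient a b a = 0 := by unfold orient; ring

lemma orient_self (a b : UpperHalfPlane) : orient a a b = 0 := by unfold orient; ring

lemma orient_add (a b c z : UpperHalfPlane) :
    orient a b z + orient b c z + orient c a z = orient a b c := by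
  unfold orient; ring

/-- The abscissa of a point in barycentric coordinates. -/
lemma re_mul_orient (a b c z : UpperHalfPlane) : z.re * orient a b c =
    a.re * orient b c z + b.re * orient c a z + c.re * orient a b z := by
  unfold orient; ring

lemma quad_mul_orient (a b c z : UpperHalfPlane) : quad z * orient a b c =
    quad a * orient b c z + quad b * orient c a z + quad c * orient a b z := by
  unfold orient; ring

/-- The triangle with the vertices `a, b, c` in positive order, as an intersection of
half-planes. -/
def tri (a b c : UpperHalfPlane) : Set UpperHalfPlane :=
  {z | 0 ≤ orient a b z ∧ 0 ≤ orient b c z ∧ 0 ≤ orient c a z}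

lemma tri_rotate (a b c : UpperHalfPlane) : tri b c a = tri a b c := by
  ext z; simp only [tri, Set.mem_ofPred_eq]; tauto

lemma measurableSet_tri (a b c : UpperHalfPlane) : MeasurableSet (tri a b c) :=
  ((continuous_orient a b).measurable measurableSet_Ici).inter
    (((continuous_orient b c).measurable measurableSet_Ici).inter
      ((continuous_orient c a).measurable measurableSet_Ici))

lemma LexLt.ne {a b : UpperHalfPlane} (h : LexLt a b) : a ≠ b := by
  rintro rfl
  rcases h with h | h
  · exact lt_irrefl _ h
  · exact lt_irrefl _ h.2

lemma LexLt.trans {a b c : UpperHalfPlane} (hab : LexLt a b) (hbc : LexLt b c) : LexLt a c := by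
  rcases hab with h1 | h1
  · exact Or.inl (h1.trans_le hbc.re_le)
  · rcases hbc with h2 | h2
    · exact Or.inl (h1.1.trans_lt h2)
    · exact Or.inr ⟨h1.1.trans h2.1, h1.2.trans h2.2⟩

lemma lexLt_or {a b : UpperHalfPlane} (h : a ≠ b) : LexLt a b ∨ LexLt b a := by
  rcases lt_trichotomy a.re b.re with h1 | h1 | h1
  · exact Or.inl (Or.inl h1)
  · rcases lt_trichotomy a.im b.im with h2 | h2 | h2
    · exact Or.inl (Or.inr ⟨h1, h2⟩)
    · exact absurd (UpperHalfPlane.ext_re_im h1 h2) h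
    · exact Or.inr (Or.inr ⟨h1.symm, h2⟩)
  · exact Or.inr (Or.inl h1)

lemma disjoint_above (a b c : UpperHalfPlane) : Disjoint (above a b) (above b c) := by
  rw [Set.disjoint_left]
  rintro z ⟨h1, -⟩ ⟨h2, -⟩
  exact absurd h1.2 (not_le.mpr h2.1)

lemma measureReal_above_union {a b c : UpperHalfPlane} (hab : LexLt a b) (hbc : LexLt b c) :
    volume (above a b ∪ above b c) ≠ ⊤ ∧ volume.real (above a b ∪ above b c) =
      (Real.pi + (dir a b).arg - (dir b a).arg) + (Real.pi + (dir b c).arg - (dir c b).arg) := by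
  obtain ⟨f1, v1⟩ := volume_above hab
  obtain ⟨f2, v2⟩ := volume_above hbc
  refine ⟨(measure_union_lt_top f1.lt_top f2.lt_top).ne, ?_⟩
  rw [measureReal_union (disjoint_above a b c) (measurableSet_above b c) f1 f2, v1, v2]

/-- A difference of arguments, corrected by full turns so as to lie in `(-π, 2 π)`, is the angle: both
differ by less than a full turn, since the angle lies in `(0, π)`. -/
lemma angle_eq_arg_sub {p b c : UpperHalfPlane} (h : 0 < orient p b c) (x : ℝ)
    (hx : ∃ k : ℤ, x = (dir p c).arg - (dir p b).arg + 2 * Real.pi * k)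
    (h1 : -Real.pi < x) (h2 : x < 2 * Real.pi) : angle b p c = x := by
  obtain ⟨a0, a1, k, hk⟩ := exists_angle_eq h
  obtain ⟨l, hl⟩ := hx
  have e : angle b p c - x = 2 * Real.pi * ((k - l : ℤ) : ℝ) := by
    push_cast
    linear_combination hk - hl
  have h0 : k - l = 0 := by
    apply int_eq_zero_of_abs_lt
    rw [← e, abs_lt]
    constructor <;> linarith
  rw [h0] at e
  simp at e
  linarith

/-- The area of a triangle whose middle vertex `b` (from left to right) is below the side `a c`. -/
lemma volume_tri_of_lexLt {a b c : UpperHalfPlane} (h : 0 < orient a b c) (hab : LexLt a b)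
    (hbc : LexLt b c) : volume (tri a b c) ≠ ⊤ ∧
    volume.real (tri a b c) = Real.pi - angle b a c - angle c b a - angle a c b := by
  have hre1 := hab.re_le
  have hre2 := hbc.re_le
  have hac := hab.trans hbc
  have hsub : above a c ⊆ above a b ∪ above b c := by
    rintro z ⟨⟨z1, z2⟩, z3⟩
    rcases le_or_gt z.re b.re with hz | hz
    · refine Or.inl ⟨⟨z1, hz⟩, ?_⟩
      have key : (c.re - a.re) * orient a b z =
          (b.re - a.re) * orient a c z + (z.re - a.re) * orient a b c := by unfold orient; ring
      have : 0 ≤ (c.re - a.re) * orient a b z := by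
        rw [key]
        have k1 : 0 ≤ (b.re - a.re) * orient a c z := mul_nonneg (by linarith) z3
        have k2 : 0 ≤ (z.re - a.re) * orient a b c := mul_nonneg (by linarith) h.le
        linarith
      exact nonneg_of_mul_nonneg_right this (by linarith)
    · refine Or.inr ⟨⟨hz, z2⟩, ?_⟩
      have key : (c.re - a.re) * orient b c z =
          (c.re - b.re) * orient a c z + (c.re - z.re) * orient a b c := by unfold orient; ring
      have : 0 ≤ (c.re - a.re) * orient b c z := by
        rw [key]
        have k1 : 0 ≤ (c.re - b.re) * orient a c z := mul_nonneg (by linarith) z3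
        have k2 : 0 ≤ (c.re - z.re) * orient a b c := mul_nonneg (by linarith) h.le
        linarith
      exact nonneg_of_mul_nonneg_right this (by linarith)
  -- the exceptional points lie on the sides or on the vertical line through `a`
  have hae : tri a b c =ᵐ[volume] ((above a b ∪ above b c) \ above a c : Set UpperHalfPlane) := by
    have n1 : ∀ᵐ z : UpperHalfPlane, z.re ≠ a.re := measure_eq_zero_iff_ae_notMem.mp (volume_re_eq _)
    have n2 : ∀ᵐ z : UpperHalfPlane, orient a c z ≠ 0 :=
      measure_eq_zero_iff_ae_notMem.mp (volume_orient_eq_zero hac.ne)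
    refine Filter.eventuallyEq_set.mpr ?_
    filter_upwards [n1, n2] with z z1 z2
    have hre := re_mul_orient a b c z
    have hadd := orient_add a b c z
    have hsw := orient_swap a c z
    constructor
    · rintro ⟨t1, t2, t3⟩
      have hza : a.re ≤ z.re := by
        have : 0 ≤ (z.re - a.re) * orient a b c := by
          have : (z.re - a.re) * orient a b c =
            (b.re - a.re) * orient c a z + (c.re - a.re) * orient a b z := by
            rw [sub_mul, hre, ← hadd]; ring
          rw [this]
          have := mul_nonneg (sub_nonneg.mpr hre1) t3
          have := mul_nonneg (sub_nonneg.mpr (hre1.trans hre2)) t1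
          linarith
        have := nonneg_of_mul_nonneg_left this h
        linarith
      have hzc : z.re ≤ c.re := by
        have : 0 ≤ (c.re - z.re) * orient a b c := by
          have : (c.re - z.re) * orient a b c =
            (c.re - b.re) * orient c a z + (c.re - a.re) * orient b c z := by
            rw [sub_mul, hre, ← hadd]; ring
          rw [this]
          have := mul_nonneg (sub_nonneg.mpr hre2) t3
          have := mul_nonneg (sub_nonneg.mpr (hre1.trans hre2)) t2
          linarith
        have := nonneg_of_mul_nonneg_left this h
        linarith
      have hza' : a.re < z.re := hza.lt_of_ne' z1
      refine ⟨?_, fun h' => z2 (le_antisymm (by linarith) h'.2)⟩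
      rcases le_or_gt z.re b.re with hz | hz
      · exact Or.inl ⟨⟨hza', hz⟩, t1⟩
      · exact Or.inr ⟨⟨hz, hzc⟩, t2⟩
    · rintro ⟨h1 | h1, h2⟩
      · obtain ⟨⟨u1, u2⟩, u3⟩ := h1
        have h3 : 0 ≤ orient c a z := by
          by_contra! hneg
          exact h2 ⟨⟨u1, u2.trans hre2⟩, by linarith⟩
        refine ⟨u3, ?_, h3⟩
        have : (b.re - a.re) * orient b c z =
            (b.re - z.re) * orient a b c + (c.re - b.re) * orient a b z := by
          rw [sub_mul (b.re) z.re, hre, ← hadd]; ring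
        have : 0 ≤ (b.re - a.re) * orient b c z := by
          rw [this]
          have := mul_nonneg (sub_nonneg.mpr u2) h.le
          have := mul_nonneg (sub_nonneg.mpr hre2) u3
          linarith
        exact nonneg_of_mul_nonneg_right this (by linarith)
      · obtain ⟨⟨u1, u2⟩, u3⟩ := h1
        have h3 : 0 ≤ orient c a z := by
          by_contra! hneg
          exact h2 ⟨⟨hre1.trans_lt u1, u2⟩, by linarith⟩
        refine ⟨?_, u3, h3⟩
        have : (c.re - b.re) * orient a b z =
            (z.re - b.re) * orient a b c + (b.re - a.re) * orient b c z := by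
          rw [sub_mul z.re, hre, ← hadd]; ring
        have : 0 ≤ (c.re - b.re) * orient a b z := by
          rw [this]
          have := mul_nonneg (sub_nonneg.mpr u1.le) h.le
          have := mul_nonneg (sub_nonneg.mpr hre1) u3
          linarith
        exact nonneg_of_mul_nonneg_right this (by linarith)
  obtain ⟨f1, v1⟩ := measureReal_above_union hab hbc
  obtain ⟨f2, v2⟩ := volume_above hac
  refine ⟨by rw [measure_congr hae]; exact measure_ne_top_of_subset Set.sdiff_subset f1, ?_⟩
  rw [measureReal_congr hae, measureReal_sdiff hsub (measurableSet_above a c) f1, v1, v2]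
  obtain ⟨ab1, ab2⟩ := arg_dir_of_lexLt hab
  obtain ⟨ba1, ba2⟩ := arg_dir_of_lexLt' hab
  obtain ⟨bc1, bc2⟩ := arg_dir_of_lexLt hbc
  obtain ⟨cb1, cb2⟩ := arg_dir_of_lexLt' hbc
  obtain ⟨ac1, ac2⟩ := arg_dir_of_lexLt hac
  obtain ⟨ca1, ca2⟩ := arg_dir_of_lexLt' hac
  rw [angle_eq_arg_sub h ((dir a c).arg - (dir a b).arg) ⟨0, by simp⟩ (by linarith) (by linarith),
    angle_eq_arg_sub (by rwa [orient_rotate]) ((dir b a).arg - (dir b c).arg) ⟨0, by simp⟩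
      (by linarith) (by linarith),
    angle_eq_arg_sub (by rwa [orient_rotate, orient_rotate]) ((dir c b).arg - (dir c a).arg)
      ⟨0, by simp⟩ (by linarith) (by linarith)]
  ring

/-- The area of a triangle whose middle vertex `c` (from left to right) is above the side `a b`. -/
lemma volume_tri_of_lexLt' {a b c : UpperHalfPlane} (h : 0 < orient a b c) (hac : LexLt a c)
    (hcb : LexLt c b) : volume (tri a b c) ≠ ⊤ ∧
    volume.real (tri a b c) = Real.pi - angle b a c - angle c b a - angle a c b := by
  have hre1 := hac.re_le
  have hre2 := hcb.re_le
  have hab := hac.trans hcb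
  have hsub : above a c ∪ above c b ⊆ above a b := by
    rintro z (⟨⟨z1, z2⟩, z3⟩ | ⟨⟨z1, z2⟩, z3⟩)
    · refine ⟨⟨z1, z2.trans hre2⟩, ?_⟩
      have key : (c.re - a.re) * orient a b z =
          (b.re - a.re) * orient a c z + (z.re - a.re) * orient a b c := by unfold orient; ring
      have : 0 ≤ (c.re - a.re) * orient a b z := by
        rw [key]
        have k1 : 0 ≤ (b.re - a.re) * orient a c z := mul_nonneg (by linarith) z3
        have k2 : 0 ≤ (z.re - a.re) * orient a b c := mul_nonneg (by linarith) h.le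
        linarith
      exact nonneg_of_mul_nonneg_right this (by linarith)
    · refine ⟨⟨hre1.trans_lt z1, z2⟩, ?_⟩
      have key : (b.re - c.re) * orient a b z =
          (b.re - a.re) * orient c b z + (b.re - z.re) * orient a b c := by unfold orient; ring
      have : 0 ≤ (b.re - c.re) * orient a b z := by
        rw [key]
        have k1 : 0 ≤ (b.re - a.re) * orient c b z := mul_nonneg (by linarith) z3
        have k2 : 0 ≤ (b.re - z.re) * orient a b c := mul_nonneg (by linarith) h.le
        linarith
      exact nonneg_of_mul_nonneg_right this (by linarith)
  -- the exceptional points lie on the sides or on the vertical line through `a`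
  have hae : tri a b c =ᵐ[volume] (above a b \ (above a c ∪ above c b) : Set UpperHalfPlane) := by
    have n1 : ∀ᵐ z : UpperHalfPlane, z.re ≠ a.re := measure_eq_zero_iff_ae_notMem.mp (volume_re_eq _)
    have n2 : ∀ᵐ z : UpperHalfPlane, orient a c z ≠ 0 :=
      measure_eq_zero_iff_ae_notMem.mp (volume_orient_eq_zero hac.ne)
    have n3 : ∀ᵐ z : UpperHalfPlane, orient c b z ≠ 0 :=
      measure_eq_zero_iff_ae_notMem.mp (volume_orient_eq_zero hcb.ne)
    refine Filter.eventuallyEq_set.mpr ?_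
    filter_upwards [n1, n2, n3] with z z1 z2 z3
    have hre := re_mul_orient a b c z
    have hadd := orient_add a b c z
    have hsw := orient_swap a c z
    have hsw' := orient_swap b c z
    constructor
    · rintro ⟨t1, t2, t3⟩
      have hza : a.re ≤ z.re := by
        have : 0 ≤ (z.re - a.re) * orient a b c := by
          have : (z.re - a.re) * orient a b c =
            (b.re - a.re) * orient c a z + (c.re - a.re) * orient a b z := by
            rw [sub_mul, hre, ← hadd]; ring
          rw [this]
          have := mul_nonneg (sub_nonneg.mpr (hre1.trans hre2)) t3
          have := mul_nonneg (sub_nonneg.mpr hre1) t1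
          linarith
        have := nonneg_of_mul_nonneg_left this h
        linarith
      have hzb : z.re ≤ b.re := by
        have : 0 ≤ (b.re - z.re) * orient a b c := by
          have : (b.re - z.re) * orient a b c =
            (b.re - c.re) * orient a b z + (b.re - a.re) * orient b c z := by
            rw [sub_mul, hre, ← hadd]; ring
          rw [this]
          have := mul_nonneg (sub_nonneg.mpr hre2) t1
          have := mul_nonneg (sub_nonneg.mpr (hre1.trans hre2)) t2
          linarith
        have := nonneg_of_mul_nonneg_left this h
        linarith
      refine ⟨⟨⟨hza.lt_of_ne' z1, hzb⟩, t1⟩, ?_⟩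
      rintro (h' | h')
      · exact z2 (le_antisymm (by linarith) h'.2)
      · exact z3 (le_antisymm (by linarith) h'.2)
    · rintro ⟨⟨⟨u1, u2⟩, u3⟩, h2⟩
      rcases le_or_gt z.re c.re with hz | hz
      · have h3 : 0 ≤ orient c a z := by
          by_contra! hneg
          exact h2 (Or.inl ⟨⟨u1, hz⟩, by linarith⟩)
        refine ⟨u3, ?_, h3⟩
        have : (c.re - a.re) * orient b c z =
            (c.re - z.re) * orient a b c + (b.re - c.re) * orient c a z := by
          rw [sub_mul (c.re) z.re, hre, ← hadd]; ring
        have : 0 ≤ (c.re - a.re) * orient b c z := by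
          rw [this]
          have := mul_nonneg (sub_nonneg.mpr hz) h.le
          have := mul_nonneg (sub_nonneg.mpr hre2) h3
          linarith
        exact nonneg_of_mul_nonneg_right this (by linarith)
      · have h3 : 0 ≤ orient b c z := by
          by_contra! hneg
          exact h2 (Or.inr ⟨⟨hz, u2⟩, by linarith⟩)
        refine ⟨u3, h3, ?_⟩
        have : (b.re - c.re) * orient c a z =
            (z.re - c.re) * orient a b c + (c.re - a.re) * orient b c z := by
          rw [sub_mul z.re, hre, ← hadd]; ring
        have : 0 ≤ (b.re - c.re) * orient c a z := by
          rw [this]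
          have := mul_nonneg (sub_nonneg.mpr hz.le) h.le
          have := mul_nonneg (sub_nonneg.mpr hre1) h3
          linarith
        exact nonneg_of_mul_nonneg_right this (by linarith)
  obtain ⟨f1, v1⟩ := measureReal_above_union hac hcb
  obtain ⟨f2, v2⟩ := volume_above hab
  refine ⟨by rw [measure_congr hae]; exact measure_ne_top_of_subset Set.sdiff_subset f2, ?_⟩
  rw [measureReal_congr hae, measureReal_sdiff hsub
    ((measurableSet_above a c).union (measurableSet_above c b)) f2, v1, v2]
  obtain ⟨ab1, ab2⟩ := arg_dir_of_lexLt hab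
  obtain ⟨ba1, ba2⟩ := arg_dir_of_lexLt' hab
  obtain ⟨cb1, cb2⟩ := arg_dir_of_lexLt hcb
  obtain ⟨bc1, bc2⟩ := arg_dir_of_lexLt' hcb
  obtain ⟨ac1, ac2⟩ := arg_dir_of_lexLt hac
  obtain ⟨ca1, ca2⟩ := arg_dir_of_lexLt' hac
  -- at the middle vertex the ray to `a` has positive and the ray to `b` nonpositive argument
  rw [angle_eq_arg_sub h ((dir a c).arg - (dir a b).arg) ⟨0, by simp⟩ (by linarith) (by linarith),
    angle_eq_arg_sub (by rwa [orient_rotate]) ((dir b a).arg - (dir b c).arg) ⟨0, by simp⟩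
      (by linarith) (by linarith),
    angle_eq_arg_sub (by rwa [orient_rotate, orient_rotate])
      ((dir c b).arg - (dir c a).arg + 2 * Real.pi) ⟨1, by simp⟩ (by linarith) (by linarith)]
  ring

/-- The area of a hyperbolic triangle is its angular defect. -/
theorem volume_tri {a b c : UpperHalfPlane} (h : 0 < orient a b c) : volume (tri a b c) ≠ ⊤ ∧
    volume.real (tri a b c) = Real.pi - angle b a c - angle c b a - angle a c b := by
  -- it suffices to treat triangles whose first vertex is the leftmost one
  have main : ∀ {a b c : UpperHalfPlane}, 0 < orient a b c → LexLt a b → LexLt a c →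
      volume (tri a b c) ≠ ⊤ ∧
      volume.real (tri a b c) = Real.pi - angle b a c - angle c b a - angle a c b := by
    intro a b c h hab hac
    have hbc : b ≠ c := by rintro rfl; simp [orient_self_right] at h
    rcases lexLt_or hbc with hbc | hcb
    · exact volume_tri_of_lexLt h hab hbc
    · exact volume_tri_of_lexLt' h hac hcb
  have hb : 0 < orient b c a := by rwa [orient_rotate]
  have hc : 0 < orient c a b := by rwa [orient_rotate, orient_rotate]
  have nab : a ≠ b := by rintro rfl; simp [orient_self] at h
  have nbc : b ≠ c := by rintro rfl; simp [orient_self_right] at h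
  have nca : c ≠ a := by rintro rfl; simp [orient_self_left] at h
  have rb := @main b c a hb
  have rc := @main c a b hc
  rw [tri_rotate] at rb
  rw [tri_rotate, tri_rotate] at rc
  rcases lexLt_or nab with ab | ba
  · rcases lexLt_or nca with ca | ac
    · obtain ⟨r1, r2⟩ := rc ca (by
        rcases lexLt_or nbc with bc | cb
        · exact absurd rfl ((ab.trans bc).trans ca).ne
        · exact cb)
      exact ⟨r1, by rw [r2]; ring⟩
    · exact main h ab ac
  · rcases lexLt_or nbc with bc | cb
    · obtain ⟨r1, r2⟩ := rb bc ba
      exact ⟨r1, by rw [r2]; ring⟩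
    · obtain ⟨r1, r2⟩ := rc (by
        rcases lexLt_or nca with ca | ac
        · exact ca
        · exact absurd rfl ((cb.trans ba).trans ac).ne)
        cb
      exact ⟨r1, by rw [r2]; ring⟩

/-! ### The area of a convex polygon -/

lemma exists_mem_chord (a b : UpperHalfPlane) {r : ℝ} (h0 : 0 ≤ r) (h1 : r ≤ 1) :
    ∃ z : UpperHalfPlane, z.re = (1 - r) * a.re + r * b.re ∧
      quad z = (1 - r) * quad a + r * quad b := by
  have ha : 0 < a.im ^ 2 := by have := a.im_pos; positivity
  have hb : 0 < b.im ^ 2 := by have := b.im_pos; positivity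
  set q : ℝ := (1 - r) * quad a + r * quad b - ((1 - r) * a.re + r * b.re) ^ 2 with hq
  have hpos : 0 < q := by
    have e : q = (1 - r) * a.im ^ 2 + r * b.im ^ 2 + r * (1 - r) * (a.re - b.re) ^ 2 := by
      rw [hq, quad, quad]; ring
    have k1 : 0 ≤ r * (1 - r) * (a.re - b.re) ^ 2 :=
      mul_nonneg (mul_nonneg h0 (by linarith)) (sq_nonneg _)
    have k2 : 0 ≤ (1 - r) * a.im ^ 2 := mul_nonneg (by linarith) ha.le
    have k3 : 0 ≤ r * b.im ^ 2 := mul_nonneg h0 hb.le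
    rcases h0.eq_or_lt with rfl | h0
    · rw [e]; nlinarith
    · have : 0 < r * b.im ^ 2 := by positivity
      rw [e]; linarith
  refine ⟨⟨⟨(1 - r) * a.re + r * b.re, Real.sqrt q⟩, Real.sqrt_pos.mpr hpos⟩, rfl, ?_⟩
  have : ∀ x y (h : 0 < y), quad ⟨⟨x, y⟩, h⟩ = x ^ 2 + y ^ 2 := fun _ _ _ => rfl
  rw [this, Real.sq_sqrt hpos.le, hq]
  ring

lemma orient_of_mem_chord {a b z : UpperHalfPlane} {r : ℝ} (h1 : z.re = (1 - r) * a.re + r * b.re)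
    (h2 : quad z = (1 - r) * quad a + r * quad b) (x y : UpperHalfPlane) :
    orient x y z = (1 - r) * orient x y a + r * orient x y b := by
  unfold orient
  rw [h1, h2]
  ring

lemma isConvex_halfPlane (x y : UpperHalfPlane) : IsConvex {z | 0 ≤ orient x y z} := by
  intro a ha b hb z hz
  obtain ⟨r, h0, h1, h2, h3⟩ := mem_seg_iff.mp hz
  rw [Set.mem_ofPred_eq, orient_of_mem_chord h2 h3]
  exact add_nonneg (mul_nonneg (by linarith) ha) (mul_nonneg h0 hb)

lemma hull_subset {X C : Set UpperHalfPlane} (hC : IsConvex C) (h : X ⊆ C) : hull X ⊆ C :=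
  Set.sInter_subset_of_mem ⟨hC, h⟩

lemma tri_subset_of_isConvex {a b c : UpperHalfPlane} {C : Set UpperHalfPlane}
    (h : 0 < orient a b c) (hC : IsConvex C) (ha : a ∈ C) (hb : b ∈ C) (hc : c ∈ C) :
    tri a b c ⊆ C := by
  rintro z ⟨h1, h2, h3⟩
  have hadd := orient_add a b c z
  have hre := re_mul_orient a b c z
  have hqu := quad_mul_orient a b c z
  rcases (add_nonneg h3 h1).eq_or_lt with h0 | h0
  · have e1 : orient c a z = 0 := by linarith
    have e2 : orient a b z = 0 := by linarith
    have e3 : orient b c z = orient a b c := by linarith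
    rw [e1, e2, e3] at hre hqu
    have : z = a := ext_chart (mul_right_cancel₀ h.ne' (by linarith))
      (mul_right_cancel₀ h.ne' (by linarith))
    rwa [this]
  · -- `z` lies on the segment from `a` to a point `d` of the opposite side
    have hle : orient a b z / (orient c a z + orient a b z) ≤ 1 := by
      rw [div_le_one h0]; linarith
    obtain ⟨d, d1, d2⟩ := exists_mem_chord b c (div_nonneg h1 h0.le) hle
    have hd : d ∈ C := hC b hb c hc (mem_seg_iff.mpr ⟨_, div_nonneg h1 h0.le, hle, d1, d2⟩)
    refine hC a ha d hd (mem_seg_iff.mpr ⟨(orient c a z + orient a b z) / orient a b c,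
      div_nonneg h0.le h.le, by rw [div_le_one h]; linarith, ?_, ?_⟩)
    · rw [d1]
      field_simp
      rw [hre, ← hadd]
      ring
    · rw [d2]
      field_simp
      rw [hqu, ← hadd]
      ring

/-- The vertices `u 0, …, u m` of a convex polygon in positive order: each side has all the other
vertices on its left. -/
structure IsConvexChain (m : ℕ) (u : ℕ → UpperHalfPlane) : Prop where
  two_le : 2 ≤ m
  side : ∀ k < m, ∀ j ≤ m, j ≠ k → j ≠ k + 1 → 0 < orient (u k) (u (k + 1)) (u j)
  last : ∀ j, 0 < j → j < m → 0 < orient (u m) (u 0) (u j)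

namespace IsConvexChain

variable {m : ℕ} {u : ℕ → UpperHalfPlane}

lemma fan_pos (h : IsConvexChain m u) {k : ℕ} (h1 : 1 ≤ k) (hk : k < m) :
    0 < orient (u 0) (u k) (u (k + 1)) := by
  rw [orient_rotate, orient_rotate]
  exact h.side k hk 0 (by omega) (by omega) (by omega)

/-- The vertices are seen from `u 0` in counterclockwise order. -/
lemma orient_zero_pos (h : IsConvexChain m u) {j k : ℕ} (hj : 1 ≤ j) (hjk : j < k) (hk : k ≤ m) :
    0 < orient (u 0) (u j) (u k) := by
  rcases hj.eq_or_lt with rfl | hj1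
  · exact h.side 0 (by omega) k hk (by omega) (by omega)
  · induction k, hjk using Nat.le_induction with
    | base => exact h.fan_pos hj (by omega)
    | succ k hjk ih =>
      have k1 := ih (by omega)
      have k2 := h.fan_pos (k := k) (by omega) (by omega)
      have k3 := h.side 0 (by omega) j (by omega) (by omega) (by omega)
      have k4 := h.side 0 (by omega) k (by omega) (by omega) (by omega)
      have k5 := h.side 0 (by omega) (k + 1) (by omega) (by omega) (by omega)
      -- a Grassmann-Plücker relation
      have pl : orient (u 0) (u 1) (u k) * orient (u 0) (u j) (u (k + 1)) =
          orient (u 0) (u 1) (u j) * orient (u 0) (u k) (u (k + 1)) +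
          orient (u 0) (u 1) (u (k + 1)) * orient (u 0) (u j) (u k) := by
        unfold orient; ring
      have : 0 < orient (u 0) (u 1) (u k) * orient (u 0) (u j) (u (k + 1)) := by
        rw [pl]; positivity
      exact pos_of_mul_pos_right this k4.le

lemma side_nonneg (h : IsConvexChain m u) {k j : ℕ} (hk : k < m) (hj : j ≤ m) :
    0 ≤ orient (u k) (u (k + 1)) (u j) := by
  by_cases h1 : j = k
  · rw [h1, orient_self_left]
  by_cases h2 : j = k + 1
  · rw [h2, orient_self_right]
  exact (h.side k hk j hj h1 h2).le

lemma last_nonneg (h : IsConvexChain m u) {j : ℕ} (hj : j ≤ m) :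
    0 ≤ orient (u m) (u 0) (u j) := by
  rcases Nat.eq_zero_or_pos j with rfl | h1
  · rw [orient_self_right]
  rcases hj.eq_or_lt with rfl | h2
  · rw [orient_self_left]
  exact (h.last j h1 h2).le

/-- The polygon is the union of the triangles of the fan with apex `u 0`. -/
lemma hull_eq (h : IsConvexChain m u) :
    hull (u '' Set.Iic m) = ⋃ k ∈ Finset.Ico 1 m, tri (u 0) (u k) (u (k + 1)) := by
  apply subset_antisymm
  · intro z hz
    have hside : ∀ k < m, 0 ≤ orient (u k) (u (k + 1)) z := by
      intro k hk
      refine hull_subset (isConvex_halfPlane _ _) ?_ hz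
      rintro _ ⟨j, hj, rfl⟩
      exact h.side_nonneg hk hj
    have hlast : 0 ≤ orient (u m) (u 0) z := by
      refine hull_subset (isConvex_halfPlane _ _) ?_ hz
      rintro _ ⟨j, hj, rfl⟩
      exact h.last_nonneg hj
    have hm := h.two_le
    -- go through the diagonals from `u 0` until `z` is on the right of one of them
    have key : ∀ k, 1 ≤ k → k < m → 0 ≤ orient (u 0) (u k) z ∨
        ∃ j ∈ Finset.Ico 1 m, z ∈ tri (u 0) (u j) (u (j + 1)) := by
      intro k hk
      induction k, hk using Nat.le_induction with
      | base => exact fun _ => Or.inl (hside 0 (by omega))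
      | succ k hk ih =>
        intro hkm
        rcases ih (by omega) with h1 | h1
        · rcases le_or_gt 0 (orient (u 0) (u (k + 1)) z) with h2 | h2
          · exact Or.inl h2
          · refine Or.inr ⟨k, Finset.mem_Ico.mpr ⟨hk, by omega⟩, h1, hside k (by omega), ?_⟩
            rw [orient_swap]; linarith
        · exact Or.inr h1
    rw [Set.mem_iUnion₂]
    rcases key (m - 1) (by omega) (by omega) with h1 | ⟨j, hj, hz⟩
    · refine ⟨m - 1, Finset.mem_Ico.mpr ⟨by omega, by omega⟩, h1, hside _ (by omega), ?_⟩
      rwa [Nat.sub_add_cancel (by omega)]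
    · exact ⟨j, hj, hz⟩
  · refine Set.iUnion₂_subset fun k hk => ?_
    obtain ⟨hk1, hk2⟩ := Finset.mem_Ico.mp hk
    refine Set.subset_sInter ?_
    rintro C ⟨hC, hsub⟩
    exact tri_subset_of_isConvex (h.fan_pos hk1 hk2) hC (hsub ⟨0, Nat.zero_le _, rfl⟩)
      (hsub ⟨k, hk2.le, rfl⟩) (hsub ⟨k + 1, hk2, rfl⟩)

lemma aedisjoint_fan (h : IsConvexChain m u) {j k : ℕ} (hj : 1 ≤ j) (hjk : j < k) (hk : k < m) :
    AEDisjoint volume (tri (u 0) (u j) (u (j + 1))) (tri (u 0) (u k) (u (k + 1))) := by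
  have hne : u 0 ≠ u (j + 1) := by
    intro h0
    have := h.fan_pos hj (by omega)
    rw [← h0, orient_self_left] at this
    exact lt_irrefl _ this
  refine measure_mono_null ?_ (volume_orient_eq_zero hne)
  rintro z ⟨⟨-, -, h1⟩, h2, -, h3⟩
  rw [orient_swap] at h1
  have hD := h.fan_pos (k := k) (by omega) hk
  have key : orient (u 0) (u k) (u (k + 1)) * orient (u 0) (u (j + 1)) z =
      orient (u 0) (u (j + 1)) (u k) * orient (u (k + 1)) (u 0) z +
      orient (u 0) (u (j + 1)) (u (k + 1)) * orient (u 0) (u k) z := by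
    unfold orient; ring
  have n1 : 0 ≤ orient (u 0) (u (j + 1)) (u k) := by
    rcases (show j + 1 ≤ k from hjk).eq_or_lt with h4 | h4
    · rw [h4, orient_self_right]
    · exact (h.orient_zero_pos (by omega) h4 hk.le).le
  have n2 := (h.orient_zero_pos (j := j + 1) (k := k + 1) (by omega) (by omega) hk).le
  have : 0 ≤ orient (u 0) (u k) (u (k + 1)) * orient (u 0) (u (j + 1)) z := by
    rw [key]; positivity
  have := nonneg_of_mul_nonneg_right this hD
  exact le_antisymm (by linarith) this

lemma angle_sum_fan (h : IsConvexChain m u) {N : ℕ} (h1 : 1 ≤ N) (hN : N < m) :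
    ∑ k ∈ Finset.Ico 1 (N + 1), (angle (u k) (u 0) (u (k + 1)) + angle (u (k + 1)) (u k) (u 0) +
      angle (u 0) (u (k + 1)) (u k)) =
    angle (u 1) (u 0) (u (N + 1)) +
      ∑ k ∈ Finset.Ico 1 (N + 1), angle (u (k + 1)) (u k) (u (k - 1)) +
      angle (u 0) (u (N + 1)) (u N) := by
  induction N, h1 using Nat.le_induction with
  | base => simp
  | succ N h1 ih =>
    rw [Finset.sum_Ico_succ_top (by omega), Finset.sum_Ico_succ_top (b := N + 1) (by omega),
      ih (by omega), Nat.add_sub_cancel]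
    have e1 : angle (u 1) (u 0) (u (N + 1 + 1)) =
        angle (u 1) (u 0) (u (N + 1)) + angle (u (N + 1)) (u 0) (u (N + 1 + 1)) :=
      angle_add (h.side 0 (by omega) _ (by omega) (by omega) (by omega))
        (h.fan_pos (by omega) hN) (h.side 0 (by omega) _ (by omega) (by omega) (by omega))
    have e2 : angle (u (N + 1 + 1)) (u (N + 1)) (u N) =
        angle (u (N + 1 + 1)) (u (N + 1)) (u 0) + angle (u 0) (u (N + 1)) (u N) := by
      refine angle_add (h.side (N + 1) hN _ (by omega) (by omega) (by omega)) ?_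
        (h.side (N + 1) hN _ (by omega) (by omega) (by omega))
      rw [orient_rotate]
      exact h.side N (by omega) 0 (by omega) (by omega) (by omega)
    rw [e1, e2]
    ring

/-- Gauss-Bonnet for convex polygons. -/
theorem volume_hull (h : IsConvexChain m u) : volume (hull (u '' Set.Iic m)) ≠ ⊤ ∧
    volume.real (hull (u '' Set.Iic m)) = ((m : ℝ) - 1) * Real.pi -
      (angle (u 1) (u 0) (u m) + ∑ k ∈ Finset.Ico 1 m, angle (u (k + 1)) (u k) (u (k - 1)) +
        angle (u 0) (u m) (u (m - 1))) := by
  have hm := h.two_le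
  have htri : ∀ k ∈ Finset.Ico 1 m, volume (tri (u 0) (u k) (u (k + 1))) ≠ ⊤ ∧
      volume.real (tri (u 0) (u k) (u (k + 1))) = Real.pi - angle (u k) (u 0) (u (k + 1)) -
        angle (u (k + 1)) (u k) (u 0) - angle (u 0) (u (k + 1)) (u k) := fun k hk =>
    volume_tri (h.fan_pos (Finset.mem_Ico.mp hk).1 (Finset.mem_Ico.mp hk).2)
  have hdis : Set.Pairwise (↑(Finset.Ico 1 m))
      (Function.onFun (AEDisjoint volume) fun k => tri (u 0) (u k) (u (k + 1))) := by
    intro j hj k hk hjk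
    obtain ⟨hj1, hj2⟩ := Finset.mem_Ico.mp hj
    obtain ⟨hk1, hk2⟩ := Finset.mem_Ico.mp hk
    rcases hjk.lt_or_gt with h1 | h1
    · exact h.aedisjoint_fan hj1 h1 hk2
    · exact (h.aedisjoint_fan hk1 h1 hj2).symm
  have hvol := measure_biUnion_finset₀ hdis fun k _ =>
    (measurableSet_tri (u 0) (u k) (u (k + 1))).nullMeasurableSet
  rw [← h.hull_eq] at hvol
  refine ⟨by rw [hvol]; exact (ENNReal.sum_lt_top.mpr fun k hk => (htri k hk).1.lt_top).ne, ?_⟩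
  rw [measureReal_def, hvol, ENNReal.toReal_sum fun k hk => (htri k hk).1]
  have hsum := h.angle_sum_fan (N := m - 1) (by omega) (by omega)
  rw [Nat.sub_add_cancel (by omega)] at hsum
  rw [← hsum, Finset.sum_congr rfl fun k hk => ((measureReal_def _ _).symm.trans (htri k hk).2)]
  simp only [sub_sub, Finset.sum_sub_distrib, Finset.sum_const, Nat.card_Ico, nsmul_eq_mul]
  rw [Nat.cast_sub (by omega)]
  simp only [Nat.cast_one, add_assoc]

end IsConvexChain

/-! ### Crossing diagonals, feet of perpendiculars and the Gauss-Bonnet formula -/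

lemma exists_ratio_of_mem_openSeg {a b z : UpperHalfPlane} (hz : z ∈ openSeg a b) :
    ∃ r : ℝ, 0 < r ∧ r < 1 ∧ z.re = (1 - r) * a.re + r * b.re ∧
      quad z = (1 - r) * quad a + r * quad b := by
  obtain ⟨hz, hza, hzb⟩ := mem_openSeg_iff.mp hz
  obtain ⟨r, h0, h1, h2, h3⟩ := mem_seg_iff.mp hz
  refine ⟨r, h0.lt_of_ne' ?_, h1.lt_of_ne ?_, h2, h3⟩
  · rintro rfl; exact hza (ext_chart (by simpa using h2) (by simpa using h3))
  · rintro rfl; exact hzb (ext_chart (by simpa using h2) (by simpa using h3))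

lemma mem_openSeg_of_chord {a b z : UpperHalfPlane} (hab : a ≠ b) {r : ℝ} (h0 : 0 < r) (h1 : r < 1)
    (h2 : z.re = (1 - r) * a.re + r * b.re) (h3 : quad z = (1 - r) * quad a + r * quad b) :
    z ∈ openSeg a b := by
  refine mem_openSeg_iff.mpr ⟨mem_seg_iff.mpr ⟨r, h0.le, h1.le, h2, h3⟩, ?_, ?_⟩
  · rintro rfl
    refine hab (ext_chart (mul_left_cancel₀ h0.ne' ?_) (mul_left_cancel₀ h0.ne' ?_))
    · linear_combination h2
    · linear_combination h3
  · have h1' : 1 - r ≠ 0 := by linarith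
    rintro rfl
    refine hab (ext_chart (mul_left_cancel₀ h1' ?_) (mul_left_cancel₀ h1' ?_))
    · linear_combination -h2
    · linear_combination -h3

lemma orient_pos_of_mem_openSeg {a b z : UpperHalfPlane} (hz : z ∈ openSeg a b)
    {x y : UpperHalfPlane} (ha : 0 ≤ orient x y a) (hb : 0 ≤ orient x y b)
    (hab : 0 < orient x y a + orient x y b) : 0 < orient x y z := by
  obtain ⟨r, h0, h1, h2, h3⟩ := exists_ratio_of_mem_openSeg hz
  rw [orient_of_mem_chord h2 h3]
  rcases ha.eq_or_lt with e | e
  · rw [← e] at hab ⊢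
    rw [mul_zero, zero_add]
    exact mul_pos h0 (by linarith)
  · exact add_pos_of_pos_of_nonneg (mul_pos (by linarith) e) (mul_nonneg h0.le hb)

/-- The diagonals of a convex quadrilateral `a s t b` cross in exactly one point. The point is found
from the linear relation between the four vertices in homogeneous coordinates. -/
theorem exists_crossing {a s t b : UpperHalfPlane} (h1 : 0 < orient s t b) (h2 : 0 < orient a s b)
    (h3 : 0 < orient a t b) (h4 : 0 < orient a s t) :
    ∃ p, p ∈ openSeg a t ∧ p ∈ openSeg b s ∧ seg a t ∩ seg b s = {p} := by
  have hat : a ≠ t := by rintro rfl; simp [orient_self_left] at h4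
  have hbs : b ≠ s := by rintro rfl; simp [orient_self_left] at h1
  have hsum : orient s t b + orient a s b = orient a t b + orient a s t := by unfold orient; ring
  have hA : 0 < orient s t b + orient a s b := by positivity
  have hr0 : 0 < orient a s b / (orient s t b + orient a s b) := by positivity
  have hr1 : orient a s b / (orient s t b + orient a s b) < 1 := by rw [div_lt_one hA]; linarith
  obtain ⟨p, p1, p2⟩ := exists_mem_chord a t hr0.le hr1.le
  have q0 : 0 < orient a t b / (orient s t b + orient a s b) := by positivity
  have q1 : orient a t b / (orient s t b + orient a s b) < 1 := by rw [div_lt_one hA]; linarith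
  have hp := mem_openSeg_of_chord hat hr0 hr1 p1 p2
  have hp' : p ∈ openSeg b s := by
    refine mem_openSeg_of_chord hbs q0 q1 ?_ ?_
    · rw [p1]
      field_simp
      unfold orient
      ring
    · rw [p2]
      field_simp
      unfold orient
      ring
  refine ⟨p, hp, hp', ?_⟩
  have hpat := (mem_openSeg_iff.mp hp).1
  have hpbs := (mem_openSeg_iff.mp hp').1
  refine subset_antisymm ?_ (Set.singleton_subset_iff.mpr ⟨hpat, hpbs⟩)
  have on_line : ∀ {x y z : UpperHalfPlane}, z ∈ seg x y → orient x y z = 0 := by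
    intro x y z hz
    obtain ⟨r, -, -, e1, e2⟩ := mem_seg_iff.mp hz
    rw [orient_of_mem_chord e1 e2, orient_self_left, orient_self_right]
    ring
  rintro z ⟨hz, hz'⟩
  have k1 := on_line hz
  have k2 := on_line hz'
  have k3 := on_line hpat
  have k4 := on_line hpbs
  -- the two lines are not parallel in the chart
  have hdet : (t.re - a.re) * (quad s - quad b) - (s.re - b.re) * (quad t - quad a) =
      -(orient s t b + orient a s b) := by
    unfold orient; ring
  have hne : -(orient s t b + orient a s b) ≠ 0 := by linarith
  rw [← hdet] at hne
  unfold orient at k1 k2 k3 k4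
  refine Set.mem_singleton_iff.mpr (ext_chart (mul_left_cancel₀ hne ?_) (mul_left_cancel₀ hne ?_))
  · linear_combination (s.re - b.re) * (k1 - k3) - (t.re - a.re) * (k2 - k4)
  · linear_combination (quad s - quad b) * (k1 - k3) - (quad t - quad a) * (k2 - k4)

lemma IsOrthProj.unique {z t t' : UpperHalfPlane} {ℓ : Set UpperHalfPlane} (h : IsOrthProj z ℓ t)
    (h' : IsOrthProj z ℓ t') : t = t' := by
  by_contra hne
  have e1 := cosh_dist_of_right_angle (h.2 t' h'.1 (Ne.symm hne))
  have e2 := cosh_dist_of_right_angle (h'.2 t h.1 hne)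
  rw [dist_comm z t', dist_comm t z, dist_comm t t'] at e1
  rw [dist_comm z t] at e2
  rw [dist_comm z t, e2] at e1
  have h1 := Real.one_lt_cosh.mpr (dist_pos.mpr (Ne.symm hne)).ne'
  nlinarith [Real.cosh_pos (dist t' z), mul_pos (Real.cosh_pos (dist t' z)) (sub_pos.mpr h1)]

/-- The foot of the perpendicular is the nearest point. -/
lemma IsOrthProj.dist_eq_infDist {z t a b : UpperHalfPlane} (h : IsOrthProj z (line a b) t)
    (ht : t ∈ seg a b) : dist z t = Metric.infDist z (seg a b) := by
  refine le_antisymm ?_ (Metric.infDist_le_dist_of_mem ht)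
  refine (Metric.le_infDist ⟨t, ht⟩).mpr fun {y} hy => ?_
  by_cases hyt : y = t
  · rw [hyt]
  have e := cosh_dist_of_right_angle (h.2 y (seg_subset_line a b hy) hyt)
  rw [dist_comm t z] at e
  have h1 := Real.one_le_cosh (dist t y)
  have h2 := Real.cosh_pos (dist z t)
  have h3 : Real.cosh (dist z t) ≤ Real.cosh (dist z y) := by rw [e]; nlinarith
  rwa [Real.cosh_le_cosh, abs_of_nonneg dist_nonneg, abs_of_nonneg dist_nonneg] at h3

/-- The area of a convex polygon is `(n - 2) π` minus the sum of its angles. -/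
theorem IsPolygon.volume_hull {n : ℕ} [NeZero n] {v : ZMod n → UpperHalfPlane}
    (h : IsPolygon n v) : volume (hull (Set.range v)) ≠ ⊤ ∧
    volume.real (hull (Set.range v)) = ((n : ℝ) - 2) * Real.pi -
      ∑ i, angle (v (i + 1)) (v i) (v (i - 1)) := by
  obtain ⟨m, rfl⟩ : ∃ m, n = m + 1 := ⟨n - 1, by have := h.three_le; omega⟩
  have hm : 2 ≤ m := by have := h.three_le; omega
  set u : ℕ → UpperHalfPlane := fun k => v (k : ZMod (m + 1)) with hu
  have cast_ne : ∀ {j k : ℕ}, j ≤ m → k ≤ m → j ≠ k → (j : ZMod (m + 1)) ≠ k := by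
    intro j k hj hk hjk h0
    rw [ZMod.natCast_eq_natCast_iff', Nat.mod_eq_of_lt (by omega), Nat.mod_eq_of_lt (by omega)] at h0
    exact hjk h0
  have hlast : (m : ZMod (m + 1)) + 1 = 0 := by
    have := ZMod.natCast_self (m + 1)
    exact_mod_cast this
  have hchain : IsConvexChain m u := by
    refine ⟨hm, fun k hk j hj h1 h2 => ?_, fun j h1 h2 => ?_⟩
    · have := h.cyclic (k : ZMod (m + 1)) j (cast_ne hj hk.le h1)
        (by exact_mod_cast cast_ne hj hk h2)
      simpa [hu] using posOriented_iff.mp this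
    · have := h.cyclic (m : ZMod (m + 1)) j (cast_ne h2.le le_rfl h2.ne)
        (by rw [hlast]; exact_mod_cast cast_ne h2.le (Nat.zero_le _) h1.ne')
      rw [hlast] at this
      simpa [hu] using posOriented_iff.mp this
  have himg : u '' Set.Iic m = Set.range v := by
    apply subset_antisymm
    · rintro _ ⟨k, -, rfl⟩
      exact ⟨_, rfl⟩
    · rintro _ ⟨i, rfl⟩
      refine ⟨i.val, Nat.lt_succ_iff.mp (ZMod.val_lt i), ?_⟩
      simp [hu]
  obtain ⟨h1, h2⟩ := hchain.volume_hull
  rw [himg] at h1 h2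
  refine ⟨h1, h2.trans ?_⟩
  have hsum : ∑ i : ZMod (m + 1), angle (v (i + 1)) (v i) (v (i - 1)) =
      ∑ k ∈ Finset.range (m + 1),
        angle (v ((k : ZMod (m + 1)) + 1)) (v k) (v ((k : ZMod (m + 1)) - 1)) := by
    refine Finset.sum_nbij' (fun i => i.val) (fun k => (k : ZMod (m + 1))) ?_ ?_ ?_ ?_ ?_
    · exact fun i _ => Finset.mem_range.mpr (ZMod.val_lt i)
    · exact fun _ _ => Finset.mem_univ _
    · exact fun i _ => ZMod.natCast_zmod_val i
    · exact fun k hk => ZMod.val_natCast_of_lt (Finset.mem_range.mp hk)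
    · intro i _
      simp only [ZMod.natCast_zmod_val]
  rw [hsum, Finset.range_eq_Ico, Finset.sum_Ico_succ_top (by omega),
    Finset.sum_eq_sum_Ico_succ_bot (show 0 < m by omega), hlast, Nat.cast_zero, zero_add]
  have e0 : (0 : ZMod (m + 1)) - 1 = m := by linear_combination -hlast
  have em : ((m - 1 : ℕ) : ZMod (m + 1)) = m - 1 := by
    rw [Nat.cast_sub (by omega), Nat.cast_one]
  have emid : ∑ k ∈ Finset.Ico 1 m, angle (u (k + 1)) (u k) (u (k - 1)) =
      ∑ k ∈ Finset.Ico (0 + 1) m,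
        angle (v ((k : ZMod (m + 1)) + 1)) (v k) (v ((k : ZMod (m + 1)) - 1)) := by
    refine Finset.sum_congr rfl fun k hk => ?_
    have := (Finset.mem_Ico.mp hk).1
    simp only [hu]
    rw [Nat.cast_sub (by omega), Nat.cast_add, Nat.cast_one]
  rw [emid, e0]
  simp only [hu, em, Nat.cast_zero, Nat.cast_one, Nat.cast_add]
  ring

/-! ### Reduced polygons -/

/-- The two perpendiculars from the end points `v i` and `v (i + M + 1)` of a longest diagonal,
where `n = 2 m + 1` and `M` is the residue class of `m`, cross and form a symmetric figure. The feet
are given in the interiors of the opposite sides; `F w` of the angle of the perpendiculars is the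
angle between a perpendicular and the side at each end point of the diagonal. -/
theorem exists_crossing_perpendiculars {n : ℕ} {w : ℝ} {v t : ZMod n → UpperHalfPlane} {M : ZMod n}
    (hM : 2 * M + 1 = 0) (hM0 : M ≠ 0) (hM1 : M + 1 ≠ 0)
    (hcyc : ∀ i j, j ≠ i → j ≠ i + 1 → 0 < orient (v i) (v (i + 1)) (v j))
    (hmem : ∀ i, t i ∈ openSeg (v (i + M)) (v (i + M + 1))) (hdist : ∀ i, dist (v i) (t i) = w)
    (hl : ∀ i, angle (v i) (t i) (v (i + M)) = Real.pi / 2)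
    (hr : ∀ i, angle (v i) (t i) (v (i + M + 1)) = Real.pi / 2) (i : ZMod n) :
    ∃ p, seg (v i) (t i) ∩ seg (v (i + M + 1)) (t (i + M + 1)) = {p} ∧
      angle (v i) p (t (i + M + 1)) = angle (t i) p (v (i + M + 1)) ∧
      F w (angle (v i) p (t (i + M + 1))) = angle (v (i + 1)) (v i) (t i) ∧
      F w (angle (v i) p (t (i + M + 1))) =
        angle (t (i + M + 1)) (v (i + M + 1)) (v (i + M)) := by
  have e1 : i + M + 1 + M = i := by linear_combination hM
  have hs : t (i + M + 1) ∈ openSeg (v i) (v (i + 1)) := by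
    have := hmem (i + M + 1)
    rwa [e1] at this
  have hd := hdist (i + M + 1)
  have hls := hl (i + M + 1)
  rw [e1] at hls
  have ht := hmem i
  have htr := hr i
  have hdt := hdist i
  set s := t (i + M + 1)
  -- the vertices `i`, `i + 1`, `i + M`, `i + M + 1` are in positive order, the middle two may agree
  have o1 : 0 < orient (v i) (v (i + 1)) (v (i + M + 1)) :=
    hcyc i _ (fun h => hM1 (by linear_combination h)) (fun h => hM0 (by linear_combination h))
  have o2 : 0 < orient (v (i + M)) (v (i + M + 1)) (v i) :=
    hcyc (i + M) i (fun h => hM0 (by linear_combination -h))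
      (fun h => hM1 (by linear_combination -h))
  have o3 : 0 ≤ orient (v i) (v (i + 1)) (v (i + M)) := by
    by_cases h : i + M = i + 1
    · rw [h, orient_self_right]
    · exact (hcyc i _ (fun h => hM0 (by linear_combination h)) h).le
  have o4 : 0 ≤ orient (v (i + M)) (v (i + M + 1)) (v (i + 1)) := by
    by_cases h : i + 1 = i + M
    · rw [h, orient_self_left]
    · refine (hcyc (i + M) _ h fun h' => hM0 ?_).le
      linear_combination -h'
  have q1 : 0 < orient (v i) (v (i + 1)) (t i) :=
    orient_pos_of_mem_openSeg ht o3 o1.le (by linarith)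
  have q2 : 0 < orient (v (i + M)) (v (i + M + 1)) s :=
    orient_pos_of_mem_openSeg hs o2.le o4 (by linarith)
  have q3 : 0 < orient (v i) s (v (i + M + 1)) := by
    rw [orient_rotate]
    have : 0 < orient (v (i + M + 1)) (v i) (v (i + 1)) := by rwa [← orient_rotate]
    refine orient_pos_of_mem_openSeg hs ?_ this.le ?_ <;> rw [orient_self_right]
    linarith
  have q4 : 0 < orient (v i) (t i) (v (i + M + 1)) := by
    rw [orient_rotate]
    have : 0 < orient (v (i + M + 1)) (v i) (v (i + M)) := by rwa [orient_rotate]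
    refine orient_pos_of_mem_openSeg ht this.le ?_ ?_ <;> rw [orient_self_left]
    linarith
  have q5 : 0 < orient (v i) s (t i) := by
    rw [orient_rotate]
    have : 0 < orient (t i) (v i) (v (i + 1)) := by rwa [← orient_rotate]
    refine orient_pos_of_mem_openSeg hs ?_ this.le ?_ <;> rw [orient_self_right]
    linarith
  have q6 : 0 < orient s (t i) (v (i + M + 1)) := by
    rw [orient_rotate]
    have : 0 < orient (v (i + M + 1)) s (v (i + M)) := by rwa [orient_rotate]
    refine orient_pos_of_mem_openSeg ht this.le ?_ ?_ <;> rw [orient_self_left]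
    linarith
  obtain ⟨p, hp, hp', hpp⟩ := exists_crossing q6 q3 q4 q5
  obtain ⟨hs1, hs2, -⟩ := mem_openSeg_iff.mp hs
  obtain ⟨ht1, -, ht2⟩ := mem_openSeg_iff.mp ht
  obtain ⟨b1, b2⟩ := butterfly hdt hd htr hls hp hp' hs2
  refine ⟨p, hpp, angle_vertical hp hp', ?_, ?_⟩
  · rw [b1, angle_eq_of_mem_seg hs1 hs2]
  · rw [b2, angle_comm s, angle_eq_of_mem_seg (by rwa [seg_comm] at ht1) ht2]

end HypPlane

theorem mainTheorem2 (n : ℕ) [NeZero n] (w : ℝ) (v t : ZMod n → UpperHalfPlane)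
    (hR : HypPlane.IsOrdinaryReduced n w v)
    (ht : ∀ i, HypPlane.IsOrthProj (v i)
      (HypPlane.line (HypPlane.opp₁ v i) (HypPlane.opp₂ v i)) (t i)) :
    ∃ (p : ZMod n → UpperHalfPlane) (φ : ZMod n → ℝ),
      (∀ i, HypPlane.seg (v i) (t i) ∩
        HypPlane.seg (HypPlane.opp₂ v i) (HypPlane.opp₂ t i) = {p i}) ∧
      (∀ i, HypPlane.angle (v i) (p i) (HypPlane.opp₂ t i) = φ i ∧
        HypPlane.angle (t i) (p i) (HypPlane.opp₂ v i) = φ i) ∧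
      MeasureTheory.volume (HypPlane.hull (Set.range v)) ≠ ⊤ ∧
      (MeasureTheory.volume (HypPlane.hull (Set.range v))).toReal =
        ((n : ℝ) - 2) * Real.pi - 2 * ∑ i, HypPlane.F w (φ i) := by
  open HypPlane in
  obtain ⟨m, hm⟩ := hR.odd
  have h3 := hR.polygon.three_le
  set M : ZMod n := (m : ZMod n)
  have hM : 2 * M + 1 = 0 := by
    have : ((2 * m + 1 : ℕ) : ZMod n) = 0 := by rw [← hm, ZMod.natCast_self]
    rwa [Nat.cast_add, Nat.cast_mul, Nat.cast_ofNat, Nat.cast_one] at this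
  have cast_ne : ∀ k : ℕ, 0 < k → k < n → (k : ZMod n) ≠ 0 := fun k h0 hk h =>
    absurd (Nat.le_of_dvd h0 ((ZMod.natCast_eq_zero_iff k n).mp h)) (not_le.mpr hk)
  have hM0 : M ≠ 0 := cast_ne m (by omega) (by omega)
  have hM1 : M + 1 ≠ 0 := by
    have := cast_ne (m + 1) (by omega) (by omega)
    rwa [Nat.cast_add, Nat.cast_one] at this
  have h2 : (2 : ZMod n) ≠ 0 := by exact_mod_cast cast_ne 2 (by omega) (by omega)
  have h1 : (1 : ZMod n) ≠ 0 := by exact_mod_cast cast_ne 1 (by omega) (by omega)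
  have hopp₁ : ∀ i, opp₁ v i = v (i + M) := fun i => by
    rw [opp₁, show (n - 1) / 2 = m by omega]
  have hopp₂ : ∀ (u : ZMod n → UpperHalfPlane) i, opp₂ u i = u (i + M + 1) := fun u i => by
    rw [opp₂, show (n + 1) / 2 = m + 1 by omega, Nat.cast_add, Nat.cast_one, add_assoc]
  have hcyc : ∀ i j, j ≠ i → j ≠ i + 1 → 0 < orient (v i) (v (i + 1)) (v j) :=
    fun i j h h' => posOriented_iff.mp (hR.polygon.cyclic i j h h')
  have hcyc' : ∀ i j, 0 ≤ orient (v i) (v (i + 1)) (v j) := fun i j => by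
    by_cases h : j = i
    · rw [h, orient_self_left]
    by_cases h' : j = i + 1
    · rw [h', orient_self_right]
    exact (hcyc i j h h').le
  have hmem' : ∀ i, t i ∈ openSeg (opp₁ v i) (opp₂ v i) := fun i => by
    obtain ⟨t', h1, h2⟩ := hR.proj_mem i
    rwa [(ht i).unique h2]
  have hdist : ∀ i, dist (v i) (t i) = w := fun i => by
    rw [(ht i).dist_eq_infDist (mem_openSeg_iff.mp (hmem' i)).1, hR.infDist_eq i]
  have hl : ∀ i, angle (v i) (t i) (v (i + M)) = Real.pi / 2 := fun i => by
    rw [← hopp₁]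
    exact (ht i).2 _ (seg_subset_line _ _ (left_mem_seg _ _)) (mem_openSeg_iff.mp (hmem' i)).2.1.symm
  have hr : ∀ i, angle (v i) (t i) (v (i + M + 1)) = Real.pi / 2 := fun i => by
    rw [← hopp₂ v]
    exact (ht i).2 _ (seg_subset_line _ _ (right_mem_seg _ _))
      (mem_openSeg_iff.mp (hmem' i)).2.2.symm
  have hmem : ∀ i, t i ∈ openSeg (v (i + M)) (v (i + M + 1)) := fun i => by
    have := hmem' i
    rwa [hopp₁, hopp₂] at this
  choose p hp hvert hF hF' using
    exists_crossing_perpendiculars hM hM0 hM1 hcyc hmem hdist hl hr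
  obtain ⟨hfin, harea⟩ := hR.polygon.volume_hull
  refine ⟨p, fun i => angle (v i) (p i) (t (i + M + 1)), fun i => ?_, fun i => ⟨?_, ?_⟩, hfin, ?_⟩
  · rw [hopp₂, hopp₂, hp]
  · rw [hopp₂]
  · rw [hopp₂, ← hvert]
  rw [MeasureTheory.measureReal_def] at harea
  rw [harea, two_mul (∑ i, _)]
  congr 1
  -- the perpendicular from `v i` splits the angle at `v i`; its parts belong to `i` and `i + M`
  have hangle : ∀ i, angle (v (i + 1)) (v i) (v (i - 1)) =
      F w (angle (v i) (p i) (t (i + M + 1))) +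
      F w (angle (v (i + M)) (p (i + M)) (t (i + M + M + 1))) := by
    intro i
    have e1 : i + M + M + 1 = i := by linear_combination hM
    have e2 : i + M + M = i - 1 := by linear_combination hM
    rw [hF i, hF' (i + M), e1, e2]
    have e3 : i - 1 + 1 = i := by ring
    have k1 : 0 < orient (v i) (v (i + 1)) (t i) := by
      have o1 := hcyc i (i + M + 1) (fun h => hM1 (by linear_combination h))
        (fun h => hM0 (by linear_combination h))
      have o2 := hcyc' i (i + M)
      exact orient_pos_of_mem_openSeg (hmem i) o2 o1.le (by linarith)
    have k2 : 0 < orient (v i) (t i) (v (i - 1)) := by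
      rw [orient_rotate]
      have o1 := hcyc (i - 1) (i + M) (fun h => hM1 (by linear_combination h))
        (by rw [e3]; exact fun h => hM0 (by linear_combination h))
      have o2 := hcyc' (i - 1) (i + M + 1)
      rw [e3] at o1 o2
      exact orient_pos_of_mem_openSeg (hmem i) o1.le o2 (by linarith)
    have k3 : 0 < orient (v i) (v (i + 1)) (v (i - 1)) :=
      hcyc i (i - 1) (fun h => h1 (by linear_combination -h))
        (fun h => h2 (by linear_combination -h))
    exact angle_add k1 k2 k3
  rw [Finset.sum_congr rfl fun i _ => hangle i, Finset.sum_add_distrib]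
  congr 1
  exact Equiv.sum_comp (Equiv.addRight M) fun i => F w (angle (v i) (p i) (t (i + M + 1)))
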